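/- Let $(\Omega,d)$ be a compact metric space with a minimal continuous flow $\sigma:\mathbb R\times\Omega\to\Omega$, $(t,\omega)\mapsto\omega\cdot t$. Equip $\mathbb R^m$ with the maximum norm, let $BC$ be the Banach space of bounded continuous functions $x:(-\infty,0]\to\mathbb R^m$ with the supremum norm $\|\cdot\|_\infty$, and for $r>0$ let $B_r=\{x\in BC:\|x\|_\infty\le r\}$. For a function $x$ on $(-\infty,a]$ or on $\mathbb R$ write $x_t(s)=x(t+s)$, $s\le 0$. Let $D:\Omega\times BC\to\mathbb R^m$ satisfy: (D1) $D(\omega,\cdot)$ is linear and continuous for $\|\cdot\|_\infty$ for each $\omega\in\Omega$, and $\omega\mapsto D(\omega,\cdot)\in\mathcal L(BC,\mathbb R^m)$ is continuous for the operator norm; (D2) for each $r>0$, $D:\Omega\times B_r\to\mathbb R^m$ is continuous when $B_r$ carries the compact-open topology; (D3) $\mu(\omega)(\{0\})$ is the identity matrix for every $\omega\in\Omega$, where $\mu(\omega)=[\mu_{ij}(\omega)]$ is the $m\times m$ matrix of finite signed Borel measures on $(-\infty,0]$ that represents $D(\omega,\cdot)$, i.e. $D(\omega,x)=\int_{-\infty}^0[d\mu(\omega)(s)]\,x(s)$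 for all $x\in BC$ (under (D1) and (D2) such a matrix exists and is unique); (D4) there is a continuous $c:[0,\infty)\to\mathbb R$ with $\lim_{t\to\infty}c(t)=0$ such that, for each $(\omega,\varphi)\in\Omega\times BC$ with $D(\omega,\varphi)=0$, the solution $x\in C(\mathbb R,\mathbb R^m)$ of $D(\omega\cdot t,x_t)=0$ $(t\ge 0)$, $x_0=\varphi$, satisfies $\|x(t)\|\le c(t)\|\varphi\|_\infty$ for all $t\ge0$. Put $\widehat D_2(\omega,x)(s)=D(\omega\cdot s,x_s)$ for $s\le 0$, and $\widehat D(\omega,x)=(\omega,\widehat D_2(\omega,x))$. Then: (i) $\widehat D:\Omega\times BC\to\Omega\times BC$ is well defined (that is, $\widehat D_2(\omega,x)\in BC$) and invertible; (ii) for every $\omega\in\Omega$, the maps $\widehat D_2(\omega,\cdot)$ and $(\widehat D^{-1})_2(\omega,\cdot)$ from $BC$ to $BC$ are linear and continuous for $\|\cdot\|_\infty$; (iii) for every $r>0$, $\widehat D$ and $\widehat D^{-1}$ are uniformly continuous on $\Omega\times B_r$ as maps from $\Omega\times B_r$ to $\Omega\times BC$ when $B_r$ and $BC$ carry the compact-open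 topology, metrized by $\mathsf d(x,y)=\sum_{n\ge1}2^{-n}\frac{\|x-y\|_n}{1+\|x-y\|_n}$, $\|x\|_n=\sup_{s\in[-n,0]}\|x(s)\|$. -/

import Mathlib

open Set Filter Topology MeasureTheory
open scoped BoundedContinuousFunction

noncomputable section

namespace StableNFDE

/-- The state space `ℝ^m`, with the maximum norm. -/
abbrev Vec (m : ℕ) : Type := Fin m → ℝ

/-- The Banach space `BC` of bounded continuous functions `(-∞, 0] → ℝ^m`, with the supremum
norm. -/
abbrev BC (m : ℕ) : Type := Iic (0 : ℝ) →ᵇ Vec m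

/-- The closed ball `B_r` of `BC`; it does not carry the topology of the supremum norm, but
the restriction of the compact-open topology, see the instance below. -/
def Ball (m : ℕ) (r : ℝ) : Type := {x : BC m // ‖x‖ ≤ r}

/-- The element of `BC` underlying an element of `B_r`. -/
def Ball.val {m : ℕ} {r : ℝ} (x : Ball m r) : BC m := Subtype.val x

/-- `B_r` with the compact-open topology, i.e. with the uniform structure of uniform convergence
on compact subsets of `(-∞, 0]`. -/
instance (m : ℕ) (r : ℝ) : UniformSpace (Ball m r) :=
  UniformSpace.comap (fun x : Ball m r => (x.val.toContinuousMap : C(Iic (0 : ℝ), Vec m)))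
    inferInstance

/-- The translation `u ↦ s + u` of `(-∞, 0]`, for `s ≤ 0`. -/
def translate (s : Iic (0 : ℝ)) : C(Iic (0 : ℝ), Iic (0 : ℝ)) where
  toFun u := ⟨s.1 + u.1, mem_Iic.2 (add_nonpos (mem_Iic.1 s.2) (mem_Iic.1 u.2))⟩
  continuous_toFun := Continuous.subtype_mk (by fun_prop) _

/-- For `x ∈ BC` and `s ≤ 0`, the element `x_s ∈ BC`, `x_s(u) = x(s + u)`. -/
def history {m : ℕ} (x : BC m) (s : Iic (0 : ℝ)) : BC m := x.compContinuous (translate s)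

/-- The flow is minimal: the only nonempty compact invariant subset is the whole space. -/
def IsMinimalFlow {Ω : Type*} [TopologicalSpace Ω] (σ : Flow ℝ Ω) : Prop :=
  ∀ K : Set Ω, K.Nonempty → IsCompact K → (∀ t : ℝ, σ t '' K = K) → K = univ

/-- `D` is continuous on `Ω × B_r` for the compact-open topology on `B_r`, for each `r > 0`. -/
def IsContinuousOnBalls {Ω : Type*} [TopologicalSpace Ω] {m : ℕ}
    (D : Ω → BC m →L[ℝ] Vec m) : Prop :=
  ∀ r : ℝ, 0 < r → Continuous (fun p : Ω × Ball m r => D p.1 p.2.val)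

/-- The matrix `μ = [μ_ij]` of finite real Borel measures on `(-∞, 0]` represents `L`:
`L x = ∫ [dμ(s)] x(s)`, that is `(L x)_i = ∑_j ∫ x_j dμ_ij`, for all `x ∈ BC`. -/
def Represents {m : ℕ} (μ : Matrix (Fin m) (Fin m) (SignedMeasure (Iic (0 : ℝ))))
    (L : BC m →L[ℝ] Vec m) : Prop :=
  ∀ (x : BC m) (i : Fin m), L x i = ∑ j, ∫ᵛ s, x s j ∂•(μ i j)

/-- `B(ω) = μ(ω)({0})` is the identity matrix for all `ω`, where `μ(ω)` is the matrix of
measures that represents `D(ω, ·)`. (This matrix is unique, and it exists as soon as `D(ω, ·)` is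
bounded, linear, and continuous on the balls `B_r` for the compact-open topology.) -/
def HasIdentityAtom {Ω : Type*} {m : ℕ} (D : Ω → BC m →L[ℝ] Vec m) : Prop :=
  ∀ (ω : Ω) (μ : Matrix (Fin m) (Fin m) (SignedMeasure (Iic (0 : ℝ)))),
    Represents μ (D ω) → (Matrix.of fun i j => μ i j {⟨0, self_mem_Iic⟩}) = (1 : Matrix (Fin m) (Fin m) ℝ)

/-- `x ∈ C(ℝ, ℝ^m)` solves `D(ω·t, x_t) = 0` for `t ≥ 0`, `x_0 = φ`. The element `y` of `BC` is
`x_t`; it exists because `x` is continuous and bounded on `(-∞, 0]`. -/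
def IsHomogeneousSolution {Ω : Type*} [TopologicalSpace Ω] {m : ℕ} (σ : Flow ℝ Ω)
    (D : Ω → BC m →L[ℝ] Vec m) (ω : Ω) (φ : BC m) (x : C(ℝ, Vec m)) : Prop :=
  (∀ s : Iic (0 : ℝ), x s = φ s) ∧
    ∀ t : ℝ, 0 ≤ t → ∃ y : BC m, (∀ s : Iic (0 : ℝ), y s = x (t + s)) ∧ D (σ t ω) y = 0

/-- `D` is stable. -/
def IsStable {Ω : Type*} [TopologicalSpace Ω] {m : ℕ} (σ : Flow ℝ Ω)
    (D : Ω → BC m →L[ℝ] Vec m) : Prop :=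
  ∃ c : ℝ → ℝ, ContinuousOn c (Ici 0) ∧ Tendsto c atTop (𝓝 0) ∧
    ∀ (ω : Ω) (φ : BC m), D ω φ = 0 → ∀ x : C(ℝ, Vec m), IsHomogeneousSolution σ D ω φ x →
      ∀ t : ℝ, 0 ≤ t → ‖x t‖ ≤ c t * ‖φ‖

/-- The function `D̂₂(ω, x) : (-∞, 0] → ℝ^m`, `s ↦ D(ω·s, x_s)`. -/
def DhatTwo {Ω : Type*} [TopologicalSpace Ω] {m : ℕ} (σ : Flow ℝ Ω)
    (D : Ω → BC m →L[ℝ] Vec m) (ω : Ω) (x : BC m) : Iic (0 : ℝ) → Vec m :=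
  fun s => D (σ s ω) (history x s)

/-- A map `T : Ω × BC → Ω × BC` is uniformly continuous on `Ω × B_r` for the compact-open
topology, for each `r > 0`. -/
def IsUniformlyContinuousOnBalls {Ω : Type*} [UniformSpace Ω] {m : ℕ}
    (T : Ω × BC m → Ω × BC m) : Prop :=
  ∀ r : ℝ, 0 < r → UniformContinuous (fun p : Ω × Ball m r =>
    (((T (p.1, p.2.val)).1, (T (p.1, p.2.val)).2.toContinuousMap) : Ω × C(Iic (0 : ℝ), Vec m)))

end StableNFDE

end

/-! The atom condition says that `D(ω, x)` is `x(0)` plus the integral of `x` against a matrix of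
measures without mass at `0`. Weighting by `e^{ls}` with `l` large makes this remainder a small
perturbation, uniformly over the compact base (`exists_expWeight`). The substitution `x(t) = e^{lt}
u(t)` then turns `D(ω·t, x_t) = h(t)` into a fixed point problem for a contraction
(`exists_weighted_solution`), so the forward equation is solvable with at most exponential growth.

Stability upgrades growth to boundedness: a solution is compared with one restarted a fixed time `T`
earlier, where `c(T) < 1/2`, and the sup bound improves itself. This gives solutions with `‖x‖ ≤
K‖h‖`, `K` independent of the initial time (`exists_bounded_solution`).

The central estimate is `norm_le_of_DhatTwo_le`. If `D̂₂(ω, z)` is at most `ε` on `[-b, 0]`,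
subtracting a bounded solution started at `-b` leaves a homogeneous solution, which decays from `-b`
on; hence `‖z(t)‖ ≤ c(t+b)(‖z‖ + Kε) + Kε`. Letting `b → ∞` yields injectivity. Applied to
differences of solutions started at `-n`, it yields a locally uniform limit and so surjectivity
(`exists_DhatTwo_eq`). With `b` finite, it is the uniform continuity of the inverse. The direct map
is handled by (D1), (D2) and compactness of the base.

Since (D3) is a condition on representing measures, their existence is needed too. It follows from
the Riesz theorem on positive functionals, (D2) excluding any loss of mass at `-∞`. -/

noncomputable section

namespace StableNFDE

section

/-! ### Riesz representation of tight bounded functionals -/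

section Riesz

open scoped NNReal CompactlySupported

variable {X : Type*} [TopologicalSpace X]

/-- A nonnegative compactly supported function as a bounded real function. -/
def toBCF (f : C_c(X, ℝ≥0)) : X →ᵇ ℝ := f.toReal.toBoundedContinuousFunction

@[simp] lemma toBCF_apply (f : C_c(X, ℝ≥0)) (x : X) : toBCF f x = f x := by
  simp [toBCF]

lemma toBCF_add (f g : C_c(X, ℝ≥0)) : toBCF (f + g) = toBCF f + toBCF g := by
  ext x; simp

lemma toBCF_smul (r : ℝ≥0) (f : C_c(X, ℝ≥0)) : toBCF (r • f) = (r : ℝ) • toBCF f := by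
  ext x; simp

lemma norm_toBCF_mono {f g : C_c(X, ℝ≥0)} (h : f ≤ g) : ‖toBCF f‖ ≤ ‖toBCF g‖ := by
  refine (BoundedContinuousFunction.norm_le (norm_nonneg _)).2 fun x => ?_
  refine le_trans ?_ ((toBCF g).norm_coe_le_norm x)
  simpa using h x

/-- The positive part of a bounded functional, on nonnegative functions of compact support. -/
def posPart (ℓ : (X →ᵇ ℝ) →L[ℝ] ℝ) (f : C_c(X, ℝ≥0)) : ℝ :=
  sSup ((fun g => ℓ (toBCF g)) '' {g | g ≤ f})

variable (ℓ : (X →ᵇ ℝ) →L[ℝ] ℝ)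

lemma le_posPart {f g : C_c(X, ℝ≥0)} (h : g ≤ f) : ℓ (toBCF g) ≤ posPart ℓ f := by
  refine le_csSup ⟨‖ℓ‖ * ‖toBCF f‖, ?_⟩ ⟨g, h, rfl⟩
  rintro _ ⟨k, hk, rfl⟩
  calc ℓ (toBCF k) ≤ ‖ℓ (toBCF k)‖ := le_abs_self _
    _ ≤ ‖ℓ‖ * ‖toBCF k‖ := ℓ.le_opNorm _
    _ ≤ _ := by gcongr; exact norm_toBCF_mono hk

lemma posPart_le {f : C_c(X, ℝ≥0)} {c : ℝ} (h : ∀ g ≤ f, ℓ (toBCF g) ≤ c) :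
    posPart ℓ f ≤ c := by
  refine csSup_le ⟨_, f, le_refl f, rfl⟩ ?_
  rintro _ ⟨k, hk, rfl⟩
  exact h k hk

lemma posPart_nonneg (f : C_c(X, ℝ≥0)) : 0 ≤ posPart ℓ f := by
  have h := le_posPart ℓ (f := f) (g := 0) (fun x => by simp)
  have h0 : toBCF (0 : C_c(X, ℝ≥0)) = 0 := by ext x; simp
  simpa [h0] using h

lemma posPart_le_norm {f : C_c(X, ℝ≥0)} (hf : ∀ x, f x ≤ 1) : posPart ℓ f ≤ ‖ℓ‖ := by
  refine posPart_le ℓ fun g hg => ?_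
  calc ℓ (toBCF g) ≤ ‖ℓ (toBCF g)‖ := le_abs_self _
    _ ≤ ‖ℓ‖ * ‖toBCF g‖ := ℓ.le_opNorm _
    _ ≤ ‖ℓ‖ * 1 := by
      gcongr
      refine (BoundedContinuousFunction.norm_le zero_le_one).2 fun x => ?_
      simpa using (hg x).trans (hf x)
    _ = _ := mul_one _

/-- Riesz decomposition: any `k ≤ f + g` splits as `k ⊓ f` plus a remainder, and the remainder is at
most `g`. -/
lemma posPart_add (f g : C_c(X, ℝ≥0)) : posPart ℓ (f + g) = posPart ℓ f + posPart ℓ g := by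
  apply le_antisymm
  · refine posPart_le ℓ fun k hk => ?_
    obtain ⟨k', hk'⟩ := CompactlySupportedContinuousMap.exists_add_of_le
      (show k ⊓ f ≤ k from inf_le_left)
    have h1 : k' ≤ g := by
      intro x
      have e : k x = min (k x) (f x) + k' x := by
        have := DFunLike.congr_fun hk' x
        simpa using this.symm
      have hx : k x ≤ f x + g x := hk x
      rcases le_total (k x) (f x) with h | h
      · rw [min_eq_left h] at e
        have : k' x = 0 := by simpa using e
        exact this.le.trans zero_le
      · rw [min_eq_right h] at e
        rw [e] at hx
        exact le_of_add_le_add_left hx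
    rw [← hk', toBCF_add, map_add]
    exact add_le_add (le_posPart ℓ inf_le_right) (le_posPart ℓ h1)
  · rw [← le_sub_iff_add_le]
    refine posPart_le ℓ fun k hk => ?_
    rw [le_sub_comm]
    refine posPart_le ℓ fun k' hk' => ?_
    rw [le_sub_iff_add_le', ← map_add, ← toBCF_add]
    exact le_posPart ℓ fun x => add_le_add (hk x) (hk' x)

lemma posPart_smul_le (r : ℝ≥0) (f : C_c(X, ℝ≥0)) :
    (r : ℝ) * posPart ℓ f ≤ posPart ℓ (r • f) := by
  rcases eq_or_ne r 0 with rfl | hr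
  · simpa using posPart_nonneg ℓ _
  have hr' : (0 : ℝ) < r := by positivity
  rw [mul_comm, ← le_div_iff₀ hr']
  refine posPart_le ℓ fun g hg => ?_
  rw [le_div_iff₀ hr', mul_comm]
  have := le_posPart ℓ (f := r • f) (g := r • g) fun x => mul_le_mul_right (hg x) r
  rwa [toBCF_smul, map_smul, smul_eq_mul] at this

lemma posPart_smul (r : ℝ≥0) (f : C_c(X, ℝ≥0)) : posPart ℓ (r • f) = r * posPart ℓ f := by
  apply le_antisymm _ (posPart_smul_le ℓ r f)
  rcases eq_or_ne r 0 with rfl | hr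
  · refine posPart_le ℓ fun g hg => ?_
    have : toBCF g = 0 := by
      ext x
      have := hg x
      simpa using this
    simp [this]
  have h := posPart_smul_le ℓ r⁻¹ (r • f)
  rw [smul_smul, inv_mul_cancel₀ hr, one_smul, NNReal.coe_inv] at h
  have hr' : (0 : ℝ) < r := by positivity
  rwa [inv_mul_le_iff₀ hr'] at h

/-- Jordan decomposition. If `f = g + k`, then `ℓ g = ℓ f + (-ℓ) k`; taking the supremum over `g`
gives one inequality, and exchanging `ℓ` with `-ℓ` gives the other. -/
lemma posPart_sub_posPart_neg (f : C_c(X, ℝ≥0)) :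
    posPart ℓ f - posPart (-ℓ) f = ℓ (toBCF f) := by
  have key : ∀ ℓ : (X →ᵇ ℝ) →L[ℝ] ℝ, posPart ℓ f ≤ ℓ (toBCF f) + posPart (-ℓ) f := by
    intro ℓ
    refine posPart_le ℓ fun g hg => ?_
    obtain ⟨k, hk⟩ := CompactlySupportedContinuousMap.exists_add_of_le hg
    have h := le_posPart (-ℓ) (f := f) (g := k) (fun x => by rw [← hk]; exact le_add_self)
    have e : ℓ (toBCF f) = ℓ (toBCF g) + ℓ (toBCF k) := by rw [← hk, toBCF_add, map_add]
    simp only [neg_apply] at h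
    linarith
  have h1 := key ℓ
  have h2 := key (-ℓ)
  have e : - -ℓ = ℓ := neg_neg ℓ
  rw [e, neg_apply] at h2
  linarith

/-- The positive part as an `ℝ≥0`-linear functional. -/
def posPartLinear : C_c(X, ℝ≥0) →ₗ[ℝ≥0] ℝ≥0 where
  toFun f := ⟨posPart ℓ f, posPart_nonneg ℓ f⟩
  map_add' f g := NNReal.eq (posPart_add ℓ f g)
  map_smul' r f := NNReal.eq (posPart_smul ℓ r f)

lemma posPartLinear_coe (f : C_c(X, ℝ≥0)) : (posPartLinear ℓ f : ℝ) = posPart ℓ f := rfl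

variable [T2Space X] [LocallyCompactSpace X] [MeasurableSpace X] [BorelSpace X]

/-- Fatou's lemma along the cutoffs bounds the total mass by `‖ℓ‖`. -/
lemma isFiniteMeasure_rieszMeasure_posPart {χ : ℕ → C_c(X, ℝ≥0)} (hχ1 : ∀ n x, χ n x ≤ 1)
    (hχ : ∀ x, Tendsto (fun n => χ n x) atTop (𝓝 1)) :
    IsFiniteMeasure (NNRealRMK.rieszMeasure (posPartLinear ℓ)) := by
  set P := NNRealRMK.rieszMeasure (posPartLinear ℓ)
  refine ⟨?_⟩
  have h1 : P univ = ∫⁻ x, liminf (fun n => (χ n x : ENNReal)) atTop ∂P := by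
    have : ∀ x, liminf (fun n => (χ n x : ENNReal)) atTop = 1 := fun x =>
      Tendsto.liminf_eq (by simpa using ENNReal.tendsto_coe.2 (hχ x))
    simp [this]
  have h2 : ∀ n, ∫⁻ x, (χ n x : ENNReal) ∂P ≤ (‖ℓ‖₊ : ENNReal) := by
    intro n
    rw [NNRealRMK.lintegral_rieszMeasure]
    exact_mod_cast posPart_le_norm ℓ (hχ1 n)
  rw [h1]
  refine (lintegral_liminf_le fun n => ?_).trans_lt
    (lt_of_le_of_lt (liminf_le_of_le (by isBoundedDefault) fun b hb => ?_)
      (ENNReal.coe_lt_top (r := ‖ℓ‖₊)))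
  · exact (ENNReal.continuous_coe.comp (χ n).continuous).measurable
  · obtain ⟨n, hn⟩ := hb.exists
    exact hn.trans (h2 n)

/-- A bounded functional which is tight with respect to a sequence of cutoff functions is the
difference of the integrals against two finite measures. -/
theorem exists_measure_sub {χ : ℕ → C_c(X, ℝ≥0)} (hχ1 : ∀ n x, χ n x ≤ 1)
    (hχ : ∀ x, Tendsto (fun n => χ n x) atTop (𝓝 1))
    (hℓ : ∀ f : X →ᵇ ℝ, Tendsto (fun n => ℓ (f * toBCF (χ n))) atTop (𝓝 (ℓ f))) :
    ∃ P N : Measure X, IsFiniteMeasure P ∧ IsFiniteMeasure N ∧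
      ∀ f : X →ᵇ ℝ, ℓ f = ∫ x, f x ∂P - ∫ x, f x ∂N := by
  refine ⟨NNRealRMK.rieszMeasure (posPartLinear ℓ), NNRealRMK.rieszMeasure (posPartLinear (-ℓ)),
    isFiniteMeasure_rieszMeasure_posPart ℓ hχ1 hχ,
    isFiniteMeasure_rieszMeasure_posPart (-ℓ) hχ1 hχ, ?_⟩
  have := isFiniteMeasure_rieszMeasure_posPart ℓ hχ1 hχ
  have := isFiniteMeasure_rieszMeasure_posPart (-ℓ) hχ1 hχ
  set P := NNRealRMK.rieszMeasure (posPartLinear ℓ)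
  set N := NNRealRMK.rieszMeasure (posPartLinear (-ℓ))
  have hpos : ∀ f : X →ᵇ ℝ, (∀ x, 0 ≤ f x) → ℓ f = ∫ x, f x ∂P - ∫ x, f x ∂N := by
    intro f hf
    let F : ℕ → C_c(X, ℝ≥0) := fun n =>
      ⟨⟨fun x => Real.toNNReal (f x) * χ n x,
        (continuous_real_toNNReal.comp f.continuous).mul (χ n).continuous⟩,
        (χ n).hasCompactSupport.mul_left⟩
    have hF : ∀ n x, (F n x : ℝ) = f x * χ n x := fun n x => by
      show ((Real.toNNReal (f x) * χ n x : ℝ≥0) : ℝ) = _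
      rw [NNReal.coe_mul, Real.coe_toNNReal _ (hf x)]
    have hF' : ∀ n, f * toBCF (χ n) = toBCF (F n) := fun n => by
      ext x; simp [hF]
    have hint : ∀ n, ℓ (f * toBCF (χ n)) = ∫ x, (F n x : ℝ) ∂P - ∫ x, (F n x : ℝ) ∂N := by
      intro n
      rw [hF', NNRealRMK.integral_rieszMeasure, NNRealRMK.integral_rieszMeasure,
        posPartLinear_coe, posPartLinear_coe, posPart_sub_posPart_neg]
    have hlim : ∀ (Q : Measure X) [IsFiniteMeasure Q],
        Tendsto (fun n => ∫ x, (F n x : ℝ) ∂Q) atTop (𝓝 (∫ x, f x ∂Q)) := by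
      intro Q _
      refine tendsto_integral_of_dominated_convergence (fun _ => ‖f‖) (fun n => ?_)
        (integrable_const _) (fun n => Eventually.of_forall fun x => ?_)
        (Eventually.of_forall fun x => ?_)
      · exact (NNReal.continuous_coe.comp (F n).continuous).aestronglyMeasurable
      · rw [hF, norm_mul]
        have h1 : ‖(χ n x : ℝ)‖ ≤ 1 := by simpa using hχ1 n x
        exact (mul_le_mul (f.norm_coe_le_norm x) h1 (norm_nonneg _) (norm_nonneg _)).trans
          (mul_one _).le
      · simp only [hF]
        have : Tendsto (fun n => (χ n x : ℝ)) atTop (𝓝 1) := by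
          simpa using NNReal.tendsto_coe.2 (hχ x)
        simpa using this.const_mul (f x)
    refine tendsto_nhds_unique (hℓ f) ?_
    simp only [hint]
    exact (hlim P).sub (hlim N)
  intro f
  -- Adding the constant `‖f‖` reduces a general `f` to the nonnegative case.
  set k : X →ᵇ ℝ := BoundedContinuousFunction.const X ‖f‖
  have h1 := hpos (f + k) fun x => by
    have := (abs_le.1 (f.norm_coe_le_norm x)).1
    simp only [k, BoundedContinuousFunction.coe_add, Pi.add_apply,
      BoundedContinuousFunction.const_apply]
    linarith
  have h2 := hpos k fun _ => norm_nonneg f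
  have hadd : ∀ (Q : Measure X) [IsFiniteMeasure Q],
      ∫ x, (f + k) x ∂Q = ∫ x, f x ∂Q + ∫ x, k x ∂Q := fun Q _ =>
    integral_add (f.integrable Q) (k.integrable Q)
  rw [map_add, hadd, hadd] at h1
  linarith

end Riesz

end

/-! ### Compact-open convergence and the matrix of measures of `D` -/

section

section CompactOpen

variable {E : Type*} [PseudoMetricSpace E]

/-- Uniform convergence on the intervals `[-a, 0]` generates the compact-open uniformity. -/
lemma hasBasis_uniformity_Iic :
    (uniformity C(Iic (0 : ℝ), E)).HasBasis (fun p : ℝ × ℝ => 0 < p.2)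
      (fun p => {fg | ∀ s : Iic (0 : ℝ), -p.1 ≤ s → dist (fg.1 s) (fg.2 s) ≤ p.2}) := by
  refine ContinuousMap.hasBasis_compactConvergenceUniformity.to_hasBasis ?_ ?_
  · rintro ⟨K, V⟩ ⟨hK, hV⟩
    obtain ⟨ε, hε, hεV⟩ := Metric.mem_uniformity_dist.1 hV
    obtain ⟨b, hb⟩ := (hK.image continuous_subtype_val).bddBelow
    refine ⟨(-b, ε / 2), half_pos hε, fun fg h x hx => hεV ?_⟩
    have := h x (by simpa using hb ⟨x, hx, rfl⟩)
    simp only at this ⊢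
    linarith
  · rintro ⟨a, ε⟩ hε
    refine ⟨({s : Iic (0 : ℝ) | -a ≤ s}, {p | dist p.1 p.2 < ε}), ⟨?_, Metric.dist_mem_uniformity hε⟩,
      fun fg h s hs => (h s hs).le⟩
    have : {s : Iic (0 : ℝ) | -a ≤ s} = Subtype.val ⁻¹' (Icc (-a) 0) := by
      ext s
      exact ⟨fun h => ⟨h, s.2⟩, fun h => h.1⟩
    rw [this]
    exact isClosed_Iic.isClosedEmbedding_subtypeVal.isCompact_preimage isCompact_Icc

lemma tendsto_compactOpen_iff {ι : Type*} {l : Filter ι} {f : ι → C(Iic (0 : ℝ), E)}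
    {g : C(Iic (0 : ℝ), E)} :
    Tendsto f l (𝓝 g) ↔ ∀ a ε : ℝ, 0 < ε →
      ∀ᶠ i in l, ∀ s : Iic (0 : ℝ), -a ≤ s → dist (f i s) (g s) ≤ ε := by
  rw [(nhds_basis_uniformity hasBasis_uniformity_Iic).tendsto_right_iff]
  exact ⟨fun h a ε hε => h (a, ε) hε, fun h p hp => h p.1 p.2 hp⟩

end CompactOpen

variable {m : ℕ}

lemma tendsto_ball_iff {ι : Type*} {l : Filter ι} {r : ℝ} {f : ι → Ball m r} {g : Ball m r} :
    Tendsto f l (𝓝 g) ↔ ∀ a ε : ℝ, 0 < ε →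
      ∀ᶠ i in l, ∀ s : Iic (0 : ℝ), -a ≤ s → dist ((f i).val s) (g.val s) ≤ ε := by
  have : IsInducing (fun x : Ball m r => (x.val.toContinuousMap : C(Iic (0 : ℝ), Vec m))) := ⟨rfl⟩
  rw [this.tendsto_nhds_iff]
  exact tendsto_compactOpen_iff

lemma hasBasis_uniformity_ball (r : ℝ) :
    (uniformity (Ball m r)).HasBasis (fun p : ℝ × ℝ => 0 < p.2)
      (fun p => {xy | ∀ s : Iic (0 : ℝ), -p.1 ≤ s → dist (xy.1.val s) (xy.2.val s) ≤ p.2}) :=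
  hasBasis_uniformity_Iic.comap _

section Continuity

variable {Ω : Type*} [TopologicalSpace Ω] {D : Ω → BC m →L[ℝ] Vec m}

lemma IsContinuousOnBalls.tendsto (hD2 : IsContinuousOnBalls D) {ι : Type*} {l : Filter ι} {r : ℝ}
    {w : ι → Ω} {w₀ : Ω} {x : ι → BC m} {y : BC m} (hw : Tendsto w l (𝓝 w₀))
    (hx : ∀ i, ‖x i‖ ≤ r) (hy : ‖y‖ ≤ r)
    (h : ∀ a ε : ℝ, 0 < ε → ∀ᶠ i in l, ∀ s : Iic (0 : ℝ), -a ≤ s → dist (x i s) (y s) ≤ ε) :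
    Tendsto (fun i => D (w i) (x i)) l (𝓝 (D w₀ y)) := by
  -- The given bound `r` need not be positive, whereas (D2) concerns balls of positive radius.
  have hr : r ≤ |r| + 1 := by linarith [le_abs_self r]
  have hc := hD2 (|r| + 1) (by positivity)
  let f : ι → Ball m (|r| + 1) := fun i => ⟨x i, (hx i).trans hr⟩
  let g : Ball m (|r| + 1) := ⟨y, hy.trans hr⟩
  have hf : Tendsto f l (𝓝 g) := tendsto_ball_iff.2 h
  exact (hc.tendsto (w₀, g)).comp (hw.prodMk_nhds hf)

end Continuity

section Cutoff

open scoped NNReal CompactlySupported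

/-- A cutoff function on `(-∞, 0]`, equal to `1` on `[-n, 0]`. -/
def cutoff (n : ℕ) : C_c(Iic (0 : ℝ), ℝ≥0) where
  toFun s := min 1 (Real.toNNReal (n + 1 + s))
  continuous_toFun := by fun_prop
  hasCompactSupport' := by
    refine HasCompactSupport.intro (K := Subtype.val ⁻¹' (Icc (-(n + 1 : ℝ)) 0))
      (isClosed_Iic.isClosedEmbedding_subtypeVal.isCompact_preimage isCompact_Icc) fun s hs => ?_
    have : (n + 1 + s : ℝ) ≤ 0 := by
      by_contra h
      push Not at h
      exact hs ⟨by linarith, s.2⟩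
    simp [Real.toNNReal_of_nonpos this]

lemma cutoff_le_one (n : ℕ) (s : Iic (0 : ℝ)) : cutoff n s ≤ 1 := min_le_left _ _

lemma cutoff_eq_one {n : ℕ} {s : Iic (0 : ℝ)} (h : -(n : ℝ) ≤ s) : cutoff n s = 1 := by
  refine min_eq_left ?_
  rw [Real.one_le_toNNReal]
  linarith

lemma tendsto_cutoff (s : Iic (0 : ℝ)) : Tendsto (fun n => cutoff n s) atTop (𝓝 1) := by
  obtain ⟨N, hN⟩ := exists_nat_ge (-(s : ℝ))
  refine tendsto_const_nhds.congr' ?_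
  filter_upwards [eventually_ge_atTop N] with n hn
  refine (cutoff_eq_one ?_).symm
  have : (N : ℝ) ≤ n := by exact_mod_cast hn
  linarith

end Cutoff

section Representation

variable {Ω : Type*} [TopologicalSpace Ω] {D : Ω → BC m →L[ℝ] Vec m}

/-- The entries of the matrix of scalar functionals of `L`. -/
def entry (L : BC m →L[ℝ] Vec m) (i j : Fin m) : (Iic (0 : ℝ) →ᵇ ℝ) →L[ℝ] ℝ :=
  (ContinuousLinearMap.proj i).comp (L.comp
    (ContinuousLinearMap.compLeftContinuousBounded _ (ContinuousLinearMap.single ℝ _ j)))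

/-- The `j`-th component of an element of `BC`. -/
def component (j : Fin m) : BC m →L[ℝ] (Iic (0 : ℝ) →ᵇ ℝ) :=
  ContinuousLinearMap.compLeftContinuousBounded _ (ContinuousLinearMap.proj j)

@[simp] lemma component_apply (j : Fin m) (x : BC m) (s : Iic (0 : ℝ)) :
    component j x s = x s j := rfl

lemma norm_component_le (j : Fin m) (x : BC m) : ‖component j x‖ ≤ ‖x‖ :=
  (BoundedContinuousFunction.norm_le (norm_nonneg _)).2 fun s =>
    (norm_le_pi_norm (x s) j).trans (x.norm_coe_le_norm s)

lemma sum_entry (L : BC m →L[ℝ] Vec m) (x : BC m) (i : Fin m) :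
    ∑ j, entry L i j (component j x) = L x i := by
  have : x = ∑ j, ContinuousLinearMap.compLeftContinuousBounded (Iic (0 : ℝ))
      (ContinuousLinearMap.single ℝ (fun _ : Fin m => ℝ) j) (component j x) := by
    ext s k
    rw [BoundedContinuousFunction.coe_sum]
    simp [Finset.sum_apply, Pi.single_apply]
  conv_rhs => rw [this]
  simp [entry]

/-- Tightness: the truncations `f χ_n` stay in one ball and converge to `f` uniformly on compact
sets, so (D2) applies. -/
lemma tendsto_entry (hD2 : IsContinuousOnBalls D) (ω : Ω) (i j : Fin m) (f : Iic (0 : ℝ) →ᵇ ℝ) :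
    Tendsto (fun n => entry (D ω) i j (f * toBCF (cutoff n))) atTop (𝓝 (entry (D ω) i j f)) := by
  have hs : ∀ g : Iic (0 : ℝ) →ᵇ ℝ, ‖ContinuousLinearMap.compLeftContinuousBounded (Iic (0 : ℝ))
      (ContinuousLinearMap.single ℝ (fun _ : Fin m => ℝ) j) g‖ ≤ ‖g‖ := fun g =>
    (BoundedContinuousFunction.norm_le (norm_nonneg _)).2 fun s => by
      simpa [Pi.norm_single] using g.norm_coe_le_norm s
  refine ((continuous_apply i).tendsto _).comp
    (hD2.tendsto (r := ‖f‖) tendsto_const_nhds (fun n => (hs _).trans ?_) (hs _) ?_)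
  · refine (BoundedContinuousFunction.norm_le (norm_nonneg _)).2 fun s => ?_
    have h1 : ‖(cutoff n s : ℝ)‖ ≤ 1 := by simpa using cutoff_le_one n s
    simpa using mul_le_mul (f.norm_coe_le_norm s) h1 (norm_nonneg _) (norm_nonneg _)
  · intro a ε hε
    obtain ⟨N, hN⟩ := exists_nat_ge a
    filter_upwards [eventually_ge_atTop N] with n hn s hs
    have : (N : ℝ) ≤ n := by exact_mod_cast hn
    simp [cutoff_eq_one (n := n) (s := s) (by linarith), hε.le]

/-- `0` as a point of `(-∞, 0]`. -/
abbrev zeroPt : Iic (0 : ℝ) := ⟨0, self_mem_Iic⟩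

/-- (D3) quantifies over representing matrices, so it has content only once one is exhibited; here
it is `P - N`, with `P` and `N` from the Riesz theorem. -/
lemma exists_measures_of_hasIdentityAtom (hD2 : IsContinuousOnBalls D) (hD3 : HasIdentityAtom D)
    (ω : Ω) : ∃ P N : Fin m → Fin m → Measure (Iic (0 : ℝ)),
      (∀ i j, IsFiniteMeasure (P i j)) ∧ (∀ i j, IsFiniteMeasure (N i j)) ∧
      (∀ i j f, entry (D ω) i j f = ∫ s, f s ∂(P i j) - ∫ s, f s ∂(N i j)) ∧
      ∀ i j, (P i j).real {zeroPt} - (N i j).real {zeroPt} = if i = j then 1 else 0 := by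
  have : LocallyCompactSpace (Iic (0 : ℝ)) := isClosed_Iic.isClosedEmbedding_subtypeVal.locallyCompactSpace
  choose P N hP hN h using fun i j =>
    exists_measure_sub (entry (D ω) i j) cutoff_le_one tendsto_cutoff (tendsto_entry hD2 ω i j)
  refine ⟨P, N, hP, hN, h, fun i j => ?_⟩
  have hrep : Represents (fun i j => (P i j).toSignedMeasure - (N i j).toSignedMeasure) (D ω) := by
    intro x i
    rw [← sum_entry]
    refine Finset.sum_congr rfl fun j _ => ?_
    -- Real multiplication is symmetric; this puts the pairing in the form used by
    -- `VectorMeasure.integral_toSignedMeasure`.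
    have hflip : (ContinuousLinearMap.lsmul ℝ ℝ : ℝ →L[ℝ] ℝ →L[ℝ] ℝ) =
        (ContinuousLinearMap.lsmul ℝ ℝ : ℝ →L[ℝ] ℝ →L[ℝ] ℝ).flip := by
      ext; simp
    have hint : ∀ (Q : Measure (Iic (0 : ℝ))) [IsFiniteMeasure Q],
        VectorMeasure.Integrable Q.toSignedMeasure fun s => x s j := by
      intro Q _
      rw [VectorMeasure.Integrable, Measure.variation_toSignedMeasure]
      exact (component j x).integrable Q
    rw [VectorMeasure.integral_sub_vectorMeasure (hint _) (hint _), hflip,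
      VectorMeasure.integral_toSignedMeasure, VectorMeasure.integral_toSignedMeasure, h]
    rfl
  have := congrFun (congrFun (hD3 ω _ hrep) i) j
  rw [Matrix.of_apply, Measure.toSignedMeasure_sub_apply (measurableSet_singleton _)] at this
  rw [this, Matrix.one_apply]

end Representation

/-! ### Exponential weights isolate the atom at `0` -/

section ExpWeight

open scoped NNReal

/-- The weight `s ↦ e^{l s}` on `(-∞, 0]`. -/
def expWeight (l : ℝ≥0) : Iic (0 : ℝ) →ᵇ ℝ :=
  BoundedContinuousFunction.ofNormedAddCommGroup (fun s => Real.exp (l * s)) (by fun_prop) 1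
    fun s => by
      rw [Real.norm_eq_abs, Real.abs_exp, Real.exp_le_one_iff]
      exact mul_nonpos_of_nonneg_of_nonpos l.2 s.2

@[simp] lemma expWeight_apply (l : ℝ≥0) (s : Iic (0 : ℝ)) :
    expWeight l s = Real.exp (l * s) := rfl

lemma norm_expWeight_smul_le (l : ℝ≥0) (x : BC m) : ‖expWeight l • x‖ ≤ ‖x‖ :=
  (BoundedContinuousFunction.norm_le (norm_nonneg _)).2 fun s => by
    show ‖Real.exp (l * s) • x s‖ ≤ _
    rw [norm_smul, Real.norm_eq_abs, Real.abs_exp]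
    refine (mul_le_of_le_one_left (norm_nonneg _) ?_).trans (x.norm_coe_le_norm s)
    rw [Real.exp_le_one_iff]
    exact mul_nonpos_of_nonneg_of_nonpos l.2 s.2

/-- The integrals against `e^{l s}` concentrate at the atom `0`. -/
lemma abs_integral_expWeight_sub_le (Q : Measure (Iic (0 : ℝ))) [IsFiniteMeasure Q] {ε : ℝ}
    (hε : 0 < ε) : ∀ᶠ l : ℝ≥0 in atTop, ∀ f : Iic (0 : ℝ) →ᵇ ℝ,
      |∫ s, (expWeight l * f) s ∂Q - Q.real {zeroPt} * f zeroPt| ≤ ε * ‖f‖ := by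
  -- Off the atom the weight tends to `0` pointwise and is dominated by `1`.
  have hlim : Tendsto (fun l : ℝ≥0 => ∫ s in {zeroPt}ᶜ, expWeight l s ∂Q) atTop (𝓝 0) := by
    rw [show 𝓝 (0 : ℝ) = 𝓝 (∫ _ in {zeroPt}ᶜ, (0 : ℝ) ∂Q) by simp]
    refine tendsto_integral_filter_of_dominated_convergence (fun _ => 1)
      (Eventually.of_forall fun l => (expWeight l).continuous.aestronglyMeasurable)
      (Eventually.of_forall fun l => Eventually.of_forall fun s => ?_) (integrable_const _) ?_
    · rw [expWeight_apply, Real.norm_eq_abs, Real.abs_exp, Real.exp_le_one_iff]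
      exact mul_nonpos_of_nonneg_of_nonpos l.2 s.2
    · rw [ae_restrict_iff' (measurableSet_singleton _).compl]
      refine Eventually.of_forall fun s hs => ?_
      have hs' : (s : ℝ) < 0 := lt_of_le_of_ne s.2 fun h => hs (Subtype.ext h)
      simp only [expWeight_apply]
      refine Real.tendsto_exp_atBot.comp ?_
      exact NNReal.tendsto_coe_atTop.2 tendsto_id |>.atTop_mul_const_of_neg hs'
  filter_upwards [hlim.eventually (gt_mem_nhds hε)] with l hl f
  have hint : Integrable (fun s => (expWeight l * f) s) Q := (expWeight l * f).integrable Q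
  rw [← integral_add_compl (measurableSet_singleton zeroPt) hint, integral_singleton]
  have e1 : Q.real {zeroPt} • (expWeight l * f) zeroPt = Q.real {zeroPt} * f zeroPt := by simp
  rw [e1, add_sub_cancel_left]
  calc |∫ s in {zeroPt}ᶜ, (expWeight l * f) s ∂Q|
      ≤ ∫ s in {zeroPt}ᶜ, expWeight l s * ‖f‖ ∂Q := by
        rw [← Real.norm_eq_abs]
        refine norm_integral_le_of_norm_le (((expWeight l).integrable _).mul_const _)
          (Eventually.of_forall fun s => ?_)
        rw [BoundedContinuousFunction.mul_apply, norm_mul, expWeight_apply, Real.norm_eq_abs,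
          Real.abs_exp]
        gcongr
        exact f.norm_coe_le_norm s
    _ = (∫ s in {zeroPt}ᶜ, expWeight l s ∂Q) * ‖f‖ := integral_mul_const _ _
    _ ≤ ε * ‖f‖ := by gcongr

variable {Ω : Type*} [TopologicalSpace Ω] {D : Ω → BC m →L[ℝ] Vec m}

lemma eventually_norm_expWeight_sub_le (hD2 : IsContinuousOnBalls D) (hD3 : HasIdentityAtom D)
    (ω : Ω) {ε : ℝ} (hε : 0 < ε) : ∀ᶠ l : ℝ≥0 in atTop, ∀ x : BC m,
      ‖D ω (expWeight l • x) - x zeroPt‖ ≤ ε * ‖x‖ := by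
  obtain ⟨P, N, hP, hN, hrep, hatom⟩ := exists_measures_of_hasIdentityAtom hD2 hD3 ω
  -- Each of the `m` entries in a row contributes an error from `P` and one from `N`; `m + 1` keeps
  -- the quotient meaningful for `m = 0`.
  set δ : ℝ := ε / (2 * (m + 1))
  have hδ : 0 < δ := by positivity
  have h1 : ∀ᶠ l : ℝ≥0 in atTop, ∀ i j, ∀ f : Iic (0 : ℝ) →ᵇ ℝ,
      |∫ s, (expWeight l * f) s ∂(P i j) - (P i j).real {zeroPt} * f zeroPt| ≤ δ * ‖f‖ :=
    eventually_all.2 fun i => eventually_all.2 fun j => abs_integral_expWeight_sub_le _ hδ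
  have h2 : ∀ᶠ l : ℝ≥0 in atTop, ∀ i j, ∀ f : Iic (0 : ℝ) →ᵇ ℝ,
      |∫ s, (expWeight l * f) s ∂(N i j) - (N i j).real {zeroPt} * f zeroPt| ≤ δ * ‖f‖ :=
    eventually_all.2 fun i => eventually_all.2 fun j => abs_integral_expWeight_sub_le _ hδ
  filter_upwards [h1, h2] with l h1 h2 x
  refine (pi_norm_le_iff_of_nonneg (by positivity)).2 fun i => ?_
  have e1 : D ω (expWeight l • x) i = ∑ j, entry (D ω) i j (expWeight l * component j x) := by
    rw [← sum_entry]
    rfl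
  have e2 : x zeroPt i = ∑ j, (if i = j then 1 else 0) * component j x zeroPt := by simp
  rw [Pi.sub_apply, e1, e2, ← Finset.sum_sub_distrib]
  refine (norm_sum_le _ _).trans ?_
  have h3 : ∀ j ∈ Finset.univ, ‖entry (D ω) i j (expWeight l * component j x) -
      (if i = j then 1 else 0) * component j x zeroPt‖ ≤ 2 * δ * ‖x‖ := by
    intro j _
    rw [hrep, ← hatom]
    have a1 := abs_le.1 (h1 i j (component j x))
    have a2 := abs_le.1 (h2 i j (component j x))
    have a3 := mul_le_mul_of_nonneg_left (norm_component_le j x) hδ.le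
    rw [Real.norm_eq_abs, abs_le]
    constructor <;> nlinarith
  refine (Finset.sum_le_sum h3).trans ?_
  rw [Finset.sum_const, Finset.card_univ, Fintype.card_fin, nsmul_eq_mul, ← mul_assoc]
  gcongr
  simp only [δ]
  rw [mul_div_assoc', mul_div_assoc', div_le_iff₀ (by positivity)]
  nlinarith

/-- For a large weight, the weighted operators are uniformly close to the evaluation at `0`. -/
theorem exists_expWeight [CompactSpace Ω] (hD1 : Continuous D) (hD2 : IsContinuousOnBalls D)
    (hD3 : HasIdentityAtom D) :
    ∃ l : ℝ≥0, ∀ (ω : Ω) (x : BC m), ‖D ω (expWeight l • x) - x zeroPt‖ ≤ 1 / 2 * ‖x‖ := by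
  suffices h : ∀ᶠ l : ℝ≥0 in atTop, ∀ ω ∈ (univ : Set Ω), ∀ x : BC m,
      ‖D ω (expWeight l • x) - x zeroPt‖ ≤ 1 / 2 * ‖x‖ by
    obtain ⟨l, hl⟩ := h.exists
    exact ⟨l, fun ω => hl ω (mem_univ ω)⟩
  refine isCompact_univ.induction_on (by simp) (fun s t hst ht => ?_) (fun s t hs ht => ?_) ?_
  · filter_upwards [ht] with l hl ω hω using hl ω (hst hω)
  · filter_upwards [hs, ht] with l h1 h2 ω hω using hω.elim (h1 ω) (h2 ω)
  · intro ω _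
    -- Half of the allowed `1/2` is spent on moving `ω'` to `ω` in operator norm, half on the
    -- estimate at `ω`.
    refine ⟨{ω' | ‖D ω' - D ω‖ ≤ 1 / 4}, ?_, ?_⟩
    · rw [nhdsWithin_univ]
      filter_upwards [(hD1.tendsto ω).eventually
        (Metric.closedBall_mem_nhds (D ω) (by norm_num : (0 : ℝ) < 1 / 4))] with ω' h
      exact (dist_eq_norm (D ω') (D ω)).symm.trans_le h
    · filter_upwards [eventually_norm_expWeight_sub_le hD2 hD3 ω (by norm_num : (0 : ℝ) < 1 / 4)]
        with l hl ω' hω' x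
      have h1 : ‖(D ω' - D ω) (expWeight l • x)‖ ≤ 1 / 4 * ‖x‖ :=
        ((D ω' - D ω).le_opNorm _).trans
          (mul_le_mul hω' (norm_expWeight_smul_le l x) (norm_nonneg _) (by norm_num))
      have e : D ω' (expWeight l • x) - x zeroPt =
          (D ω' - D ω) (expWeight l • x) + (D ω (expWeight l • x) - x zeroPt) := by
        simp
      rw [e]
      refine (norm_add_le _ _).trans ?_
      linarith [hl x]

end ExpWeight

end

/-! ### Solving the equation forward in time -/

section

open scoped NNReal

variable {m : ℕ}

/-- A bound that improves itself by halving up to a constant. -/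
lemma le_two_mul_of_halving {α : Type*} {f : α → ℝ} {B C : ℝ} (hC : ∀ a, f a ≤ C)
    (h : ∀ M, (∀ a, f a ≤ M) → ∀ a, f a ≤ M / 2 + B) (a : α) : f a ≤ 2 * B := by
  have : Nonempty α := ⟨a⟩
  have hbdd : BddAbove (range f) := ⟨C, by rintro _ ⟨a, rfl⟩; exact hC a⟩
  have h1 : ∀ a, f a ≤ ⨆ a, f a := fun a => le_ciSup hbdd a
  have h2 : ⨆ a, f a ≤ (⨆ a, f a) / 2 + B := ciSup_le (h _ h1)
  linarith [h1 a]

/-- For a bounded continuous function `u` on `ℝ`, the element `u_t` of `BC`. -/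
def past (u : ℝ →ᵇ Vec m) (t : ℝ) : BC m :=
  u.compContinuous ⟨fun s : Iic (0 : ℝ) => t + s, by fun_prop⟩

@[simp] lemma past_apply (u : ℝ →ᵇ Vec m) (t : ℝ) (s : Iic (0 : ℝ)) : past u t s = u (t + s) := rfl

@[simp] lemma history_apply (x : BC m) (s u : Iic (0 : ℝ)) : history x s u =
    x ⟨s + u, mem_Iic.2 (add_nonpos (mem_Iic.1 s.2) (mem_Iic.1 u.2))⟩ := rfl

lemma norm_past_le (u : ℝ →ᵇ Vec m) (t : ℝ) : ‖past u t‖ ≤ ‖u‖ :=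
  (BoundedContinuousFunction.norm_le (norm_nonneg _)).2 fun _ => u.norm_coe_le_norm _

lemma norm_history_le (x : BC m) (s : Iic (0 : ℝ)) : ‖history x s‖ ≤ ‖x‖ :=
  (BoundedContinuousFunction.norm_le (norm_nonneg _)).2 fun _ => x.norm_coe_le_norm _

/-- The extension of an element of `BC` to `ℝ` which is constant on `[0, ∞)`. -/
def extend (x : BC m) : ℝ →ᵇ Vec m :=
  x.compContinuous ⟨fun t : ℝ => ⟨min t 0, mem_Iic.2 (min_le_right _ _)⟩,
    Continuous.subtype_mk (by fun_prop) _⟩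

lemma extend_apply (x : BC m) (t : ℝ) : extend x t = x ⟨min t 0, mem_Iic.2 (min_le_right _ _)⟩ := rfl

lemma extend_of_nonpos (x : BC m) (s : Iic (0 : ℝ)) : extend x s = x s := by
  rw [extend_apply]
  congr
  exact min_eq_left s.2

lemma norm_extend_le (x : BC m) : ‖extend x‖ ≤ ‖x‖ :=
  (BoundedContinuousFunction.norm_le (norm_nonneg _)).2 fun _ => x.norm_coe_le_norm _

lemma past_extend (x : BC m) (s : Iic (0 : ℝ)) : past (extend x) s = history x s := by
  ext u i
  rw [past_apply, history_apply, extend_apply]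
  exact congrArg (x · i) (Subtype.ext (min_eq_left (add_nonpos (mem_Iic.1 s.2) (mem_Iic.1 u.2))))

lemma history_zeroPt (x : BC m) : history x zeroPt = x := by
  ext u i
  simp

/-- Histories depend continuously on time, for uniform convergence on compact sets. -/
lemma eventually_dist_past_le (u : ℝ →ᵇ Vec m) (t₀ a ε : ℝ) (hε : 0 < ε) :
    ∀ᶠ t in 𝓝 t₀, ∀ s : Iic (0 : ℝ), -a ≤ s → dist (past u t s) (past u t₀ s) ≤ ε := by
  let F : C(ℝ, C(Iic (0 : ℝ), Vec m)) := ContinuousMap.curry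
    ⟨fun p : ℝ × Iic (0 : ℝ) => u (p.1 + p.2), by fun_prop⟩
  exact tendsto_compactOpen_iff.1 (F.continuous.tendsto t₀) a ε hε

section Flow

variable {Ω : Type*} [TopologicalSpace Ω] {D : Ω → BC m →L[ℝ] Vec m} {σ : Flow ℝ Ω}

lemma continuous_apply_smul_past (hD2 : IsContinuousOnBalls D) (l : ℝ≥0) (ω : Ω)
    (u : ℝ →ᵇ Vec m) : Continuous fun t => D (σ t ω) (expWeight l • past u t) := by
  refine continuous_iff_continuousAt.2 fun t₀ => ?_
  refine hD2.tendsto (r := ‖u‖) (σ.continuous continuous_id continuous_const).continuousAt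
    (fun t => (norm_expWeight_smul_le l _).trans (norm_past_le u t))
    ((norm_expWeight_smul_le l _).trans (norm_past_le u t₀)) fun a ε hε => ?_
  filter_upwards [eventually_dist_past_le u t₀ a ε hε] with t ht s hs
  refine le_trans ?_ (ht s hs)
  show dist (Real.exp (l * s) • past u t s) (Real.exp (l * s) • past u t₀ s) ≤ _
  rw [dist_smul₀, Real.norm_eq_abs, Real.abs_exp]
  refine mul_le_of_le_one_left dist_nonneg (Real.exp_le_one_iff.2 ?_)
  exact mul_nonpos_of_nonneg_of_nonpos l.2 s.2

lemma continuous_apply_past (hD2 : IsContinuousOnBalls D) (ω : Ω)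
    (u : ℝ →ᵇ Vec m) : Continuous fun t => D (σ t ω) (past u t) := by
  have h : ∀ x : BC m, expWeight 0 • x = x := fun x => by
    ext s i
    show (Real.exp ((0 : ℝ≥0) * s) • x s) i = x s i
    simp
  simpa only [h] using continuous_apply_smul_past (σ := σ) hD2 0 ω u

lemma continuous_DhatTwo (hD2 : IsContinuousOnBalls D) (ω : Ω) (x : BC m) :
    Continuous (DhatTwo σ D ω x) := by
  have := (continuous_apply_past (σ := σ) hD2 ω (extend x)).comp
    (continuous_subtype_val (p := fun t : ℝ => t ∈ Iic (0 : ℝ)))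
  refine this.congr fun s => ?_
  simp [DhatTwo, past_extend]

/-- The weighted equation on the whole line is solvable. -/
theorem exists_weighted_solution (hD2 : IsContinuousOnBalls D) {l : ℝ≥0}
    (hl : ∀ (ω : Ω) (x : BC m), ‖D ω (expWeight l • x) - x zeroPt‖ ≤ 1 / 2 * ‖x‖)
    (ω : Ω) (g : ℝ →ᵇ Vec m) : ∃ u : ℝ →ᵇ Vec m, ‖u‖ ≤ 2 * ‖g‖ ∧
      (∀ t, D (σ t ω) (expWeight l • past u t) = g t) ∧
      ((∀ t ≤ 0, g t = 0) → ∀ t ≤ 0, u t = 0) := by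
  have hN : ∀ (u : ℝ →ᵇ Vec m) (t : ℝ),
      ‖D (σ t ω) (expWeight l • past u t) - u t‖ ≤ 1 / 2 * ‖past u t‖ := fun u t => by
    simpa using hl (σ t ω) (past u t)
  -- The equation reads `u + N u = g` with `N` linear of norm at most `1/2`.
  let N : (ℝ →ᵇ Vec m) → (ℝ →ᵇ Vec m) := fun u =>
    BoundedContinuousFunction.ofNormedAddCommGroup
      (fun t => D (σ t ω) (expWeight l • past u t) - u t)
      ((continuous_apply_smul_past hD2 l ω u).sub u.continuous) (1 / 2 * ‖u‖)
      fun t => (hN u t).trans (by gcongr; exact norm_past_le u t)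
  have hNapp : ∀ u t, N u t = D (σ t ω) (expWeight l • past u t) - u t := fun _ _ => rfl
  have hNnorm : ∀ u, ‖N u‖ ≤ 1 / 2 * ‖u‖ := fun u =>
    (BoundedContinuousFunction.norm_le (by positivity)).2 fun t =>
      (hN u t).trans (by gcongr; exact norm_past_le u t)
  have hNsub : ∀ u v, N u - N v = N (u - v) := fun u v => by
    ext t i
    have : expWeight l • past (u - v) t = expWeight l • past u t - expWeight l • past v t := by
      ext s i
      exact congrFun (smul_sub (Real.exp (l * s)) (u (t + s)) (v (t + s))) i
    simp only [BoundedContinuousFunction.sub_apply, hNapp, this, map_sub, Pi.sub_apply]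
    ring
  have hcontr : ContractingWith (1 / 2 : ℝ≥0) fun u => g - N u := by
    refine ⟨by rw [← NNReal.coe_lt_coe]; norm_num, LipschitzWith.of_dist_le_mul fun u v => ?_⟩
    rw [dist_eq_norm, dist_eq_norm, sub_sub_sub_cancel_left, hNsub, norm_sub_rev u v]
    simpa using hNnorm (v - u)
  set u := ContractingWith.fixedPoint _ hcontr
  have hu : g - N u = u := hcontr.fixedPoint_isFixedPt
  have hut : ∀ t, g t - N u t = u t := fun t => DFunLike.congr_fun hu t
  refine ⟨u, ?_, fun t => ?_, fun hg => ?_⟩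
  · have : ‖u‖ ≤ ‖g‖ + ‖N u‖ := by
      conv_lhs => rw [← hu]
      exact norm_sub_le _ _
    linarith [hNnorm u]
  · have := hut t
    rw [hNapp, sub_sub_eq_add_sub, sub_eq_iff_eq_add, add_comm (g t)] at this
    exact (add_left_cancel this).symm
  -- For `t ≤ 0` the equation only sees `u` on `(-∞, 0]`, where `g = 0`; there any bound on `u` can
  -- be halved, so `u` vanishes.
  · have key := le_two_mul_of_halving (α := Iic (0 : ℝ)) (f := fun t => ‖u t‖) (B := 0)
      (fun t => u.norm_coe_le_norm _) fun M hM t => by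
        have hM0 : 0 ≤ M := (norm_nonneg _).trans (hM t)
        have h1 := hut t
        rw [hg t t.2, zero_sub] at h1
        have h2 : ‖past u t‖ ≤ M := (BoundedContinuousFunction.norm_le hM0).2 fun s =>
          hM ⟨t + s, mem_Iic.2 (add_nonpos (mem_Iic.1 t.2) (mem_Iic.1 s.2))⟩
        have h3 := hN u t
        rw [← hNapp] at h3
        show ‖u t‖ ≤ _
        rw [← h1, norm_neg]
        linarith
    intro t ht
    have := key ⟨t, ht⟩
    exact norm_le_zero_iff.1 (by simpa using this)

/-- `x` satisfies `D(ω·t, x_t) = h(t)` for all `t ≥ a`. -/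
def Solves (σ : Flow ℝ Ω) (D : Ω → BC m →L[ℝ] Vec m) (ω : Ω) (x h : ℝ → Vec m) (a : ℝ) : Prop :=
  ∀ t, a ≤ t → ∃ y : BC m, (∀ s : Iic (0 : ℝ), y s = x (t + s)) ∧ D (σ t ω) y = h t

lemma Solves.mono {ω : Ω} {x h : ℝ → Vec m} {a b : ℝ} (H : Solves σ D ω x h a) (hab : a ≤ b) :
    Solves σ D ω x h b := fun t ht => H t (hab.trans ht)

lemma Solves.sub {ω : Ω} {x x' h h' : ℝ → Vec m} {a : ℝ} (H : Solves σ D ω x h a)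
    (H' : Solves σ D ω x' h' a) : Solves σ D ω (x - x') (h - h') a := fun t ht => by
  obtain ⟨y, hy, e⟩ := H t ht
  obtain ⟨y', hy', e'⟩ := H' t ht
  exact ⟨y - y', fun s => by simp [hy, hy'], by simp [e, e']⟩

lemma Solves.apply_past {ω : Ω} {x : ℝ →ᵇ Vec m} {h : ℝ → Vec m} {a t : ℝ}
    (H : Solves σ D ω x h a) (ht : a ≤ t) : D (σ t ω) (past x t) = h t := by
  obtain ⟨y, hy, e⟩ := H t ht
  rw [← e]
  congr 1
  ext s i
  rw [past_apply, hy]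

lemma Solves.shift {ω : Ω} {x h : ℝ → Vec m} {a : ℝ} (b : ℝ)
    (H : Solves σ D (σ b ω) x h a) :
    Solves σ D ω (fun t => x (t - b)) (fun t => h (t - b)) (a + b) := fun t ht => by
  obtain ⟨y, hy, e⟩ := H (t - b) (by linarith)
  refine ⟨y, fun s => (hy s).trans (congrArg x (by ring)), ?_⟩
  rwa [← σ.map_add, sub_add_cancel] at e

/-- The function `e^{-l t} f(t)` for `t ≥ 0`, constant for `t ≤ 0`. -/
def damp (l : ℝ≥0) (f : ℝ →ᵇ Vec m) : ℝ →ᵇ Vec m :=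
  BoundedContinuousFunction.ofNormedAddCommGroup (fun t => Real.exp (-(l * max t 0)) • f (max t 0))
    (by fun_prop) ‖f‖ fun t => by
      rw [norm_smul, Real.norm_eq_abs, Real.abs_exp]
      refine (mul_le_of_le_one_left (norm_nonneg _) (Real.exp_le_one_iff.2 ?_)).trans
        (f.norm_coe_le_norm _)
      exact neg_nonpos.2 (mul_nonneg l.2 (le_max_right _ _))

lemma damp_apply (l : ℝ≥0) (f : ℝ →ᵇ Vec m) (t : ℝ) :
    damp l f t = Real.exp (-(l * max t 0)) • f (max t 0) := rfl

lemma norm_damp_le (l : ℝ≥0) (f : ℝ →ᵇ Vec m) : ‖damp l f‖ ≤ ‖f‖ :=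
  BoundedContinuousFunction.norm_ofNormedAddCommGroup_le _ (norm_nonneg _) _

/-- Undoing the weight. -/
lemma apply_exp_smul_past {ω : Ω} {l : ℝ≥0} {u : ℝ →ᵇ Vec m} {f : ℝ →ᵇ Vec m} {t : ℝ} (ht : 0 ≤ t)
    (h : D (σ t ω) (expWeight l • past u t) = damp l f t) :
    D (σ t ω) (Real.exp (l * t) • (expWeight l • past u t)) = f t := by
  rw [map_smul, h, damp_apply, max_eq_left ht, smul_smul, ← Real.exp_add, add_neg_cancel,
    Real.exp_zero, one_smul]

lemma exp_smul_past_apply (l : ℝ≥0) (u : ℝ →ᵇ Vec m) (t : ℝ) (s : Iic (0 : ℝ)) :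
    (Real.exp (l * t) • (expWeight l • past u t)) s = Real.exp (l * (t + s)) • u (t + s) := by
  show Real.exp (l * t) • (Real.exp (l * s) • u (t + s)) = _
  rw [smul_smul, ← Real.exp_add, mul_add]

/-- Solutions on `[0, ∞)` with exponential growth. -/
lemma exists_solution_exp (hD2 : IsContinuousOnBalls D) {l : ℝ≥0}
    (hl : ∀ (ω : Ω) (x : BC m), ‖D ω (expWeight l • x) - x zeroPt‖ ≤ 1 / 2 * ‖x‖)
    (ω : Ω) (h : ℝ →ᵇ Vec m) : ∃ x : C(ℝ, Vec m),
      (∀ t, ‖x t‖ ≤ 2 * ‖h‖ * Real.exp (l * t)) ∧ Solves σ D ω x h 0 := by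
  obtain ⟨u, hu, hsol, -⟩ := exists_weighted_solution (σ := σ) hD2 hl ω (damp l h)
  refine ⟨⟨fun t => Real.exp (l * t) • u t, by fun_prop⟩, fun t => ?_, fun t ht =>
    ⟨_, exp_smul_past_apply l u t, apply_exp_smul_past ht (hsol t)⟩⟩
  show ‖Real.exp (l * t) • u t‖ ≤ _
  rw [norm_smul, Real.norm_eq_abs, Real.abs_exp, mul_comm]
  gcongr
  exact (u.norm_coe_le_norm t).trans (hu.trans (by gcongr; exact norm_damp_le l h))

/-- The initial value problem for the homogeneous equation is solvable. -/
lemma exists_isHomogeneousSolution [CompactSpace Ω] (hD1 : Continuous D)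
    (hD2 : IsContinuousOnBalls D) {l : ℝ≥0}
    (hl : ∀ (ω : Ω) (x : BC m), ‖D ω (expWeight l • x) - x zeroPt‖ ≤ 1 / 2 * ‖x‖)
    {ω : Ω} {φ : BC m} (hφ : D ω φ = 0) :
    ∃ x : C(ℝ, Vec m), IsHomogeneousSolution σ D ω φ x := by
  obtain ⟨C, hC⟩ := isCompact_univ.exists_bound_of_continuousOn
    (E := BC m →L[ℝ] Vec m) (f := D) hD1.continuousOn
  -- Minus the value of `D` along the constant extension of `φ`. It vanishes at time `0` because `D
  -- ω φ = 0`, so `damp l k` vanishes on `(-∞, 0]` and the correction `u` preserves the initial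
  -- data.
  let k : ℝ →ᵇ Vec m := BoundedContinuousFunction.ofNormedAddCommGroup
    (fun t => -D (σ t ω) (past (extend φ) t)) (continuous_apply_past hD2 ω _).neg (C * ‖extend φ‖)
    fun t => by
      rw [norm_neg]
      have hC' := hC (σ t ω) (mem_univ _)
      exact ((D (σ t ω)).le_opNorm _).trans (mul_le_mul hC' (norm_past_le _ _) (norm_nonneg _)
        ((norm_nonneg _).trans hC'))
  have hk : ∀ t, k t = -D (σ t ω) (past (extend φ) t) := fun _ => rfl
  obtain ⟨u, -, hsol, hu0⟩ := exists_weighted_solution (σ := σ) hD2 hl ω (damp l k)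
  have hu0 := hu0 fun t ht => by
    have := past_extend φ zeroPt
    rw [history_zeroPt] at this
    rw [damp_apply, max_eq_right ht, hk, this, σ.map_zero_apply, hφ, neg_zero, smul_zero]
  refine ⟨⟨fun t => extend φ t + Real.exp (l * t) • u t, by fun_prop⟩, fun s => ?_, fun t ht =>
    ⟨past (extend φ) t + Real.exp (l * t) • (expWeight l • past u t), fun s => ?_, ?_⟩⟩
  · show extend φ s + Real.exp (l * s) • u s = φ s
    rw [hu0 s s.2, smul_zero, add_zero, extend_of_nonpos]
  · rw [BoundedContinuousFunction.add_apply, exp_smul_past_apply]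
    rfl
  · rw [map_add, apply_exp_smul_past ht (hsol t), hk, add_neg_cancel]

end Flow

end

/-! ### Bounded solutions and the a priori estimate from stability -/

section

open scoped NNReal

variable {m : ℕ} {Ω : Type*} [TopologicalSpace Ω] {D : Ω → BC m →L[ℝ] Vec m} {σ : Flow ℝ Ω}

/-- Solutions of the homogeneous equation on `[a, ∞)` decay with rate `c`. -/
def Decays (σ : Flow ℝ Ω) (D : Ω → BC m →L[ℝ] Vec m) (c : ℝ → ℝ) : Prop :=
  ∀ (ω : Ω) (x : C(ℝ, Vec m)) (a M : ℝ), Solves σ D ω x 0 a → (∀ s ≤ a, ‖x s‖ ≤ M) →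
    ∀ t, a ≤ t → ‖x t‖ ≤ c (t - a) * M

lemma IsStable.exists_decays (hD4 : IsStable σ D) :
    ∃ c : ℝ → ℝ, (∀ t, 0 ≤ c t) ∧ Tendsto c atTop (𝓝 0) ∧ Decays σ D c := by
  obtain ⟨c, -, hc, H⟩ := hD4
  refine ⟨fun t => |c t|, fun t => abs_nonneg _, by simpa using hc.abs,
    fun ω x a M hx hM t ht => ?_⟩
  obtain ⟨φ, hφ, hφ0⟩ := hx a le_rfl
  have hφM : ‖φ‖ ≤ M := (BoundedContinuousFunction.norm_le
    ((norm_nonneg _).trans (hM a le_rfl))).2 fun s => by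
      rw [hφ]
      exact hM _ (by linarith [mem_Iic.1 s.2])
  let x' : C(ℝ, Vec m) := ⟨fun t => x (a + t), by fun_prop⟩
  have h := H (σ a ω) φ hφ0 x' ⟨fun s => (hφ s).symm, fun t ht => ?_⟩ (t - a) (by linarith)
  · have e : x' (t - a) = x t := congrArg x (by ring)
    rw [e] at h
    refine h.trans ?_
    exact (mul_le_mul_of_nonneg_right (le_abs_self _) (norm_nonneg _)).trans
      (mul_le_mul_of_nonneg_left hφM (abs_nonneg _))
  · obtain ⟨y, hy, hy0⟩ := hx (t + a) (by linarith)
    refine ⟨y, fun s => (hy s).trans (congrArg x (by ring)), ?_⟩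
    rw [← σ.map_add]
    exact hy0

/-- Under stability, the inhomogeneous equation on `[a, ∞)` has a solution bounded by a multiple
of the right-hand side. -/
theorem exists_bounded_solution (hD2 : IsContinuousOnBalls D) {l : ℝ≥0}
    (hl : ∀ (ω : Ω) (x : BC m), ‖D ω (expWeight l • x) - x zeroPt‖ ≤ 1 / 2 * ‖x‖)
    {c : ℝ → ℝ} (hc : Tendsto c atTop (𝓝 0)) (hdec : Decays σ D c) :
    ∃ K : ℝ, 0 ≤ K ∧ ∀ (ω : Ω) (h : ℝ →ᵇ Vec m) (a : ℝ), ∃ x : ℝ →ᵇ Vec m,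
      ‖x‖ ≤ K * ‖h‖ ∧ Solves σ D ω x h a := by
  obtain ⟨T, hT, hT0⟩ := ((hc.eventually (gt_mem_nhds (by norm_num : (0 : ℝ) < 1 / 2))).and
    (eventually_ge_atTop 0)).exists
  have hstart : ∀ (ω : Ω) (h : ℝ →ᵇ Vec m) (a : ℝ), ∃ x : C(ℝ, Vec m),
      (∀ t, ‖x t‖ ≤ 2 * ‖h‖ * Real.exp (l * (t - a))) ∧ Solves σ D ω x h a := by
    intro ω h a
    obtain ⟨x, hx, hs⟩ := exists_solution_exp (σ := σ) hD2 hl (σ a ω)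
      (h.compContinuous ⟨fun t => t + a, by fun_prop⟩)
    refine ⟨⟨fun t => x (t - a), by fun_prop⟩, fun t => (hx (t - a)).trans ?_, ?_⟩
    · gcongr
      exact (BoundedContinuousFunction.norm_le (norm_nonneg _)).2 fun _ => h.norm_coe_le_norm _
    · have := hs.shift a
      rw [zero_add] at this
      refine fun t ht => (this t ht).imp fun y hy => ⟨hy.1, hy.2.trans ?_⟩
      exact congrArg h (by simp)
  -- The exponential covers the growth of a solution over a time `T`; the `1` comes from `c T * (2 *
  -- ‖h‖) ≤ ‖h‖`.
  set B : ℝ := 1 + 2 * Real.exp (l * T)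
  refine ⟨2 * B, by positivity, fun ω h a => ?_⟩
  obtain ⟨x, hx, hs⟩ := hstart ω h a
  have hexp : ∀ s r : ℝ, s ≤ r → 2 * ‖h‖ * Real.exp (l * s) ≤ 2 * ‖h‖ * Real.exp (l * r) :=
    fun s r hsr => by gcongr
  have hexp0 : ∀ s ≤ (0 : ℝ), 2 * ‖h‖ * Real.exp (l * s) ≤ 2 * ‖h‖ := fun s hs => by
    simpa using hexp s 0 hs
  have hbound : ∀ t, ‖x t‖ ≤ 2 * (B * ‖h‖) := by
    intro A
    -- On `(-∞, A]` the growth bound supplies the finite a priori bound; it depends on `A`, but the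
    -- improved bound does not.
    refine le_two_mul_of_halving (α := Iic A) (f := fun t => ‖x t‖)
      (C := 2 * ‖h‖ * Real.exp (l * (A - a)))
      (fun t => (hx t).trans (hexp _ _ (by linarith [mem_Iic.1 t.2]))) (fun M hM t => ?_)
      ⟨A, self_mem_Iic⟩
    have hM0 : 0 ≤ M := (norm_nonneg _).trans (hM t)
    have hB : B * ‖h‖ = ‖h‖ + 2 * ‖h‖ * Real.exp (l * T) := by simp only [B]; ring
    rcases le_total (t : ℝ) (a + T) with ht | ht
    · have := (hx t).trans (hexp _ T (by linarith))
      rw [hB]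
      show ‖x t‖ ≤ _
      linarith [norm_nonneg h]
    -- Restart at `t - T`: `x - y` is homogeneous from there on and shrinks by `c T < 1/2` up to
    -- time `t`.
    · obtain ⟨y, hy, hys⟩ := hstart ω h (t - T)
      have hd : Solves σ D ω (x - y) 0 (t - T) := by
        simpa using (hs.mono (by linarith : a ≤ t - T)).sub hys
      have h1 := hdec ω (x - y) (t - T) (M + 2 * ‖h‖) hd (fun s hs => by
        refine (norm_sub_le _ _).trans (add_le_add (hM ⟨s, ?_⟩) ((hy s).trans (hexp0 _ ?_)))
        · exact mem_Iic.2 (by linarith [mem_Iic.1 t.2])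
        · linarith) t (by linarith)
      have h2 := hy t
      rw [sub_sub_cancel] at h1 h2
      have h3 : c T * (M + 2 * ‖h‖) ≤ 1 / 2 * (M + 2 * ‖h‖) := by gcongr
      have h4 : ‖x t‖ ≤ ‖(x - y) t‖ + ‖y t‖ := by
        simpa using norm_add_le ((x - y) t) (y t)
      show ‖x t‖ ≤ _
      linarith
  refine ⟨BoundedContinuousFunction.ofNormedAddCommGroup x x.continuous _ hbound, ?_, hs⟩
  refine (BoundedContinuousFunction.norm_ofNormedAddCommGroup_le _ (by positivity) _).trans ?_
  rw [mul_assoc]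

/-- A priori estimate for elements of `BC`, in terms of the recent values of `D(ω·s, z_s)`. -/
theorem norm_le_of_DhatTwo_le [CompactSpace Ω] (hD1 : Continuous D) (hD2 : IsContinuousOnBalls D)
    {l : ℝ≥0} (hl : ∀ (ω : Ω) (x : BC m), ‖D ω (expWeight l • x) - x zeroPt‖ ≤ 1 / 2 * ‖x‖)
    {c : ℝ → ℝ} (hdec : Decays σ D c) {K : ℝ} (hK0 : 0 ≤ K)
    (hK : ∀ (ω : Ω) (h : ℝ →ᵇ Vec m) (a : ℝ), ∃ x : ℝ →ᵇ Vec m,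
      ‖x‖ ≤ K * ‖h‖ ∧ Solves σ D ω x h a)
    {ω : Ω} {z : BC m} {b ε : ℝ} (hε : 0 ≤ ε)
    (hz : ∀ s : Iic (0 : ℝ), -b ≤ s → ‖DhatTwo σ D ω z s‖ ≤ ε) (t : Iic (0 : ℝ)) (ht : -b ≤ t) :
    ‖z t‖ ≤ c (t + b) * (‖z‖ + K * ε) + K * ε := by
  have hb : -b ≤ 0 := ht.trans t.2
  -- Freezing `D̂₂(ω, z)` outside `[-b, 0]` makes it a right-hand side on all of `ℝ` of norm at most
  -- `ε`.
  let clip : C(ℝ, Iic (0 : ℝ)) := ⟨fun t => ⟨max (-b) (min t 0),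
    mem_Iic.2 (max_le hb (min_le_right _ _))⟩, Continuous.subtype_mk (by fun_prop) _⟩
  have hclip : ∀ s : Iic (0 : ℝ), -b ≤ s → clip s = s := fun s hs => by
    refine Subtype.ext ?_
    show max (-b) (min (s : ℝ) 0) = s
    rw [min_eq_left (mem_Iic.1 s.2), max_eq_right hs]
  have hpε : ∀ t, ‖DhatTwo σ D ω z (clip t)‖ ≤ ε := fun t => hz _ (le_max_left _ _)
  let p : ℝ →ᵇ Vec m := BoundedContinuousFunction.ofNormedAddCommGroup
    (fun t => DhatTwo σ D ω z (clip t)) ((continuous_DhatTwo hD2 ω z).comp clip.continuous) ε hpε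
  have hpnorm : ‖p‖ ≤ ε := BoundedContinuousFunction.norm_ofNormedAddCommGroup_le _ hε _
  have hp : ∀ s : Iic (0 : ℝ), -b ≤ s → p s = D (σ s ω) (history z s) := fun s hs =>
    congrArg (DhatTwo σ D ω z) (hclip s hs)
  obtain ⟨w, hw, hws⟩ := hK ω p (-b)
  have hwε : ‖w‖ ≤ K * ε := hw.trans (by gcongr)
  have hdiff : ∀ s : Iic (0 : ℝ), -b ≤ s → D (σ s ω) (history z s - past w s) = 0 := by
    intro s hs
    rw [map_sub, hws.apply_past hs, hp s hs, sub_self]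
  have h0 : D ω (z - past w 0) = 0 := by
    have := hdiff zeroPt hb
    rwa [history_zeroPt, σ.map_zero_apply] at this
  -- Stability concerns solutions on all of `ℝ`, so `z - w` is continued past time `0`.
  obtain ⟨x, hx, hsol⟩ := exists_isHomogeneousSolution (σ := σ) hD1 hD2 hl h0
  have hxz : ∀ s : Iic (0 : ℝ), x s = z s - w s := fun s => by
    rw [hx, BoundedContinuousFunction.sub_apply, past_apply, zero_add]
  have hsolves : Solves σ D ω x 0 (-b) := by
    intro t ht
    rcases le_total 0 t with h | h
    · exact hsol t h
    · refine ⟨history z ⟨t, h⟩ - past w t, fun s => ?_, hdiff ⟨t, h⟩ ht⟩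
      exact (hxz ⟨t + s, mem_Iic.2 (add_nonpos h (mem_Iic.1 s.2))⟩).symm
  have h1 := hdec ω x (-b) (‖z‖ + K * ε) hsolves (fun s hs => by
    rw [hxz ⟨s, mem_Iic.2 (hs.trans hb)⟩]
    exact (norm_sub_le _ _).trans (add_le_add (z.norm_coe_le_norm _)
      ((w.norm_coe_le_norm _).trans hwε))) t ht
  rw [sub_neg_eq_add, hxz] at h1
  have h2 : ‖z t‖ ≤ ‖z t - w t‖ + ‖w t‖ := by simpa using norm_add_le (z t - w t) (w t)
  linarith [(w.norm_coe_le_norm t).trans hwε]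

end

/-! ### Inversion of `D̂₂` and uniform continuity -/

section

open scoped NNReal

variable {m : ℕ}

section Estimates

variable {Ω : Type*} {D : Ω → BC m →L[ℝ] Vec m}

/-- The function `D̂₂(ω, x)` controls `x`: far from the left end of an interval, `x` is bounded
by the values of `D̂₂(ω, x)` in this interval. -/
def APriori [TopologicalSpace Ω] (σ : Flow ℝ Ω) (D : Ω → BC m →L[ℝ] Vec m) (c : ℝ → ℝ)
    (K : ℝ) : Prop :=
  ∀ (ω : Ω) (z : BC m) (b ε : ℝ), 0 ≤ ε →
    (∀ s : Iic (0 : ℝ), -b ≤ s → ‖DhatTwo σ D ω z s‖ ≤ ε) →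
    ∀ t : Iic (0 : ℝ), -b ≤ t → ‖z t‖ ≤ c (t + b) * (‖z‖ + K * ε) + K * ε

section Topological

variable [TopologicalSpace Ω] {σ : Flow ℝ Ω}

lemma DhatTwo_add (ω : Ω) (x y : BC m) :
    DhatTwo σ D ω (x + y) = DhatTwo σ D ω x + DhatTwo σ D ω y :=
  funext fun s => map_add (D (σ s ω)) (history x s) (history y s)

lemma DhatTwo_smul (ω : Ω) (r : ℝ) (x : BC m) :
    DhatTwo σ D ω (r • x) = r • DhatTwo σ D ω x :=
  funext fun s => map_smul (D (σ s ω)) r (history x s)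

lemma DhatTwo_sub (ω : Ω) (x y : BC m) :
    DhatTwo σ D ω (x - y) = DhatTwo σ D ω x - DhatTwo σ D ω y :=
  funext fun s => map_sub (D (σ s ω)) (history x s) (history y s)

/-- Eventual smallness of `c` far to the right. -/
lemma eventually_le_of_tendsto {c : ℝ → ℝ} (hc : Tendsto c atTop (𝓝 0)) (a B : ℝ) {ε : ℝ}
    (hε : 0 < ε) :
    ∀ᶠ b : ℝ in atTop, a ≤ b ∧ ∀ t : ℝ, -a ≤ t → c (t + b) * B ≤ ε := by
  have h : Tendsto (fun t => c t * B) atTop (𝓝 0) := by simpa using hc.mul_const B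
  obtain ⟨N, hN⟩ := eventually_atTop.1 (h.eventually (gt_mem_nhds hε))
  filter_upwards [eventually_ge_atTop (a + N), eventually_ge_atTop a] with b hb hab
  exact ⟨hab, fun t ht => (hN _ (by linarith)).le⟩

/-- The a priori estimate with `ε = 0`, as `b → ∞`. -/
lemma eq_zero_of_DhatTwo_eq_zero {c : ℝ → ℝ} {K : ℝ} (hc : Tendsto c atTop (𝓝 0))
    (hap : APriori σ D c K) {ω : Ω} {z : BC m} (hz : DhatTwo σ D ω z = 0) : z = 0 := by
  ext t : 1
  refine norm_le_zero_iff.1 (le_of_forall_pos_le_add fun ε hε => ?_)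
  obtain ⟨b, hb, hb'⟩ := (eventually_le_of_tendsto hc (-t) ‖z‖ hε).exists
  have := hap ω z b 0 le_rfl (fun s _ => by simp [hz]) t (by linarith)
  have h2 := hb' t (by simp)
  rw [mul_zero, add_zero, add_zero] at this
  linarith

/-- Surjectivity of `D̂₂(ω, ·)`, with a bound for the preimage. -/
theorem exists_DhatTwo_eq (hD2 : IsContinuousOnBalls D) {c : ℝ → ℝ} {K : ℝ} (hK0 : 0 ≤ K)
    (hc0 : ∀ t, 0 ≤ c t) (hc : Tendsto c atTop (𝓝 0)) (hap : APriori σ D c K)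
    (hK : ∀ (ω : Ω) (h : ℝ →ᵇ Vec m) (a : ℝ), ∃ x : ℝ →ᵇ Vec m,
      ‖x‖ ≤ K * ‖h‖ ∧ Solves σ D ω x h a) (ω : Ω) (h : BC m) :
    ∃ x : BC m, ‖x‖ ≤ K * ‖h‖ ∧ DhatTwo σ D ω x = h := by
  -- Solutions started at `-n` have `D̂₂` equal to `h` on `[-n, 0]`; two of them differ near `0`
  -- only by a decaying homogeneous part.
  choose u hu hus using fun n : ℕ => hK ω (extend h) (-n)
  let y : ℕ → BC m := fun n =>
    (u n).compContinuous ⟨fun s : Iic (0 : ℝ) => (s : ℝ), continuous_subtype_val⟩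
  have hyn : ∀ n, ‖y n‖ ≤ K * ‖h‖ := fun n =>
    (BoundedContinuousFunction.norm_le (by positivity)).2 fun s =>
      ((u n).norm_coe_le_norm s).trans ((hu n).trans (by gcongr; exact norm_extend_le h))
  have hyD : ∀ (n : ℕ), ∀ s : Iic (0 : ℝ), -(n : ℝ) ≤ s → DhatTwo σ D ω (y n) s = h s := by
    intro n s hs
    rw [← extend_of_nonpos, ← (hus n).apply_past hs]
    rfl
  have hdist : ∀ a ε : ℝ, 0 < ε → ∃ N : ℕ, ∀ n ≥ N, ∀ k ≥ N, ∀ s : Iic (0 : ℝ), -a ≤ s →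
      dist (y n s) (y k s) ≤ ε := by
    intro a ε hε
    obtain ⟨N, hN, hN'⟩ := (tendsto_natCast_atTop_atTop.eventually
      (eventually_le_of_tendsto hc a (2 * (K * ‖h‖)) hε)).exists
    refine ⟨N, fun n hn k hk s hs => ?_⟩
    have hn' : (N : ℝ) ≤ n := Nat.cast_le.2 hn
    have hk' : (N : ℝ) ≤ k := Nat.cast_le.2 hk
    have h1 := hap ω (y n - y k) N 0 le_rfl (fun t ht => by
      rw [DhatTwo_sub, Pi.sub_apply, hyD n t (by linarith), hyD k t (by linarith), sub_self,
        norm_zero]) s (by linarith)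
    rw [mul_zero, add_zero, add_zero, BoundedContinuousFunction.sub_apply, ← dist_eq_norm] at h1
    refine h1.trans (le_trans ?_ (hN' s hs))
    refine mul_le_mul_of_nonneg_left ((norm_sub_le _ _).trans ?_) (hc0 _)
    linarith [hyn n, hyn k]
  have : LocallyCompactSpace (Iic (0 : ℝ)) :=
    isClosed_Iic.isClosedEmbedding_subtypeVal.locallyCompactSpace
  obtain ⟨g, hg⟩ := cauchySeq_tendsto_of_complete (u := fun n => (y n).toContinuousMap)
    (hasBasis_uniformity_Iic.cauchySeq_iff.2 fun p hp =>
      (hdist p.1 p.2 hp).imp fun N hN n hn k hk => hN n hn k hk)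
  have hglim := tendsto_compactOpen_iff.1 hg
  have hgn : ∀ s, ‖g s‖ ≤ K * ‖h‖ := fun s => by
    refine le_of_forall_pos_le_add fun ε hε => ?_
    obtain ⟨n, hn⟩ := (hglim (-s) ε hε).exists
    have h1 := hn s (by simp)
    have h2 := (y n).norm_coe_le_norm s
    rw [dist_comm, dist_eq_norm] at h1
    have h3 : ‖g s‖ ≤ ‖g s - y n s‖ + ‖y n s‖ := by simpa using norm_add_le (g s - y n s) (y n s)
    exact h3.trans (by linarith [hyn n, show ‖g s - y n s‖ ≤ ε from h1])
  let x : BC m := BoundedContinuousFunction.ofNormedAddCommGroup g g.continuous _ hgn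
  have hx : ‖x‖ ≤ K * ‖h‖ :=
    BoundedContinuousFunction.norm_ofNormedAddCommGroup_le _ (by positivity) _
  refine ⟨x, hx, funext fun s => ?_⟩
  have hlim : Tendsto (fun n => DhatTwo σ D ω (y n) s) atTop (𝓝 (DhatTwo σ D ω x s)) := by
    refine hD2.tendsto (r := K * ‖h‖) tendsto_const_nhds
      (fun n => (norm_history_le _ _).trans (hyn n)) ((norm_history_le _ _).trans hx) ?_
    intro a ε hε
    filter_upwards [hglim (a - s) ε hε] with n hn u hu
    refine hn ⟨s + u, mem_Iic.2 (add_nonpos (mem_Iic.1 s.2) (mem_Iic.1 u.2))⟩ ?_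
    show -(a - s) ≤ (s + u : ℝ)
    linarith
  refine tendsto_nhds_unique hlim (tendsto_const_nhds.congr' ?_)
  filter_upwards [tendsto_natCast_atTop_atTop.eventually (eventually_ge_atTop (-(s : ℝ)))] with n hn
  exact (hyD n s (by linarith)).symm

/-- Separates the change of function from the change of base point, for both uniform continuity
proofs. -/
lemma DhatTwo_sub_DhatTwo (ω ω' : Ω) (x y : BC m) (s : Iic (0 : ℝ)) :
    DhatTwo σ D ω x s - DhatTwo σ D ω' y s =
      DhatTwo σ D ω (x - y) s + (D (σ s ω) - D (σ s ω')) (history y s) := by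
  rw [DhatTwo_sub, Pi.sub_apply, sub_apply]
  simp only [DhatTwo]
  abel

lemma norm_sub_history_le {ω ω' : Ω} {y : BC m} {s : Iic (0 : ℝ)} {r δ : ℝ} (hδ : 0 ≤ δ)
    (hy : ‖y‖ ≤ r)
    (h : ‖D (σ s ω) - D (σ s ω')‖ ≤ δ / (r + 1)) :
    ‖(D (σ s ω) - D (σ s ω')) (history y s)‖ ≤ δ := by
  have hr : 0 ≤ r := (norm_nonneg y).trans hy
  calc ‖(D (σ s ω) - D (σ s ω')) (history y s)‖ ≤ δ / (r + 1) * (r + 1) :=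
      ((D (σ s ω) - D (σ s ω')).le_opNorm _).trans (mul_le_mul h
        ((norm_history_le y s).trans (by linarith)) (norm_nonneg _) (by positivity))
    _ = δ := div_mul_cancel₀ _ (by positivity)

end Topological

section Uniform

variable [MetricSpace Ω]

lemma uniformContinuous_of_dist_le {r : ℝ} {F : Ω × Ball m r → C(Iic (0 : ℝ), Vec m)}
    (h : ∀ a ε : ℝ, 0 < ε → ∃ η b δ : ℝ, 0 < η ∧ 0 < δ ∧ ∀ p q : Ω × Ball m r,
      dist p.1 q.1 < η → (∀ s : Iic (0 : ℝ), -b ≤ s → dist (p.2.val s) (q.2.val s) ≤ δ) →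
      ∀ s : Iic (0 : ℝ), -a ≤ s → dist (F p s) (F q s) ≤ ε) : UniformContinuous F := by
  refine hasBasis_uniformity_Iic.tendsto_right_iff.2 ?_
  rintro ⟨a, ε⟩ hε
  obtain ⟨η, b, δ, hη, hδ, H⟩ := h a ε hε
  filter_upwards [uniformContinuous_fst (Metric.dist_mem_uniformity hη),
    uniformContinuous_snd ((hasBasis_uniformity_ball r).mem_of_mem (i := (b, δ)) hδ)] with p h1 h2
  exact H p.1 p.2 h1 h2

variable [CompactSpace Ω] {σ : Flow ℝ Ω}

/-- Smallness on a long interval makes `D(ω, z)` small, uniformly in `ω`. -/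
lemma exists_tail (hD2 : IsContinuousOnBalls D) {r ε : ℝ} (hr : 0 < r) (hε : 0 < ε) :
    ∃ b δ : ℝ, 0 < δ ∧ ∀ (ω : Ω) (z : BC m), ‖z‖ ≤ r →
      (∀ s : Iic (0 : ℝ), -b ≤ s → ‖z s‖ ≤ δ) → ‖D ω z‖ ≤ ε := by
  suffices h : ∃ b δ : ℝ, 0 < δ ∧ ∀ ω ∈ (univ : Set Ω), ∀ z : BC m, ‖z‖ ≤ r →
      (∀ s : Iic (0 : ℝ), -b ≤ s → ‖z s‖ ≤ δ) → ‖D ω z‖ ≤ ε by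
    obtain ⟨b, δ, hδ, h⟩ := h
    exact ⟨b, δ, hδ, fun ω => h ω (mem_univ ω)⟩
  refine isCompact_univ.induction_on ⟨0, 1, one_pos, by simp⟩ ?_ ?_ ?_
  · rintro s t hst ⟨b, δ, hδ, h⟩
    exact ⟨b, δ, hδ, fun ω hω => h ω (hst hω)⟩
  · rintro s t ⟨b, δ, hδ, h⟩ ⟨b', δ', hδ', h'⟩
    refine ⟨max b b', min δ δ', lt_min hδ hδ', fun ω hω z hz hzs => hω.elim (fun hω => ?_)
      fun hω => ?_⟩
    · exact h ω hω z hz fun s hs => (hzs s (by linarith [le_max_left b b'])).trans (min_le_left _ _)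
    · exact h' ω hω z hz fun s hs =>
        (hzs s (by linarith [le_max_right b b'])).trans (min_le_right _ _)
  -- Joint continuity at `(ω, 0)` gives the claim near `ω`.
  · intro ω _
    let o : Ball m r := ⟨0, by simpa using hr.le⟩
    have ho : D ω o.val = 0 := map_zero _
    have hc := (hD2 r hr).tendsto (ω, o)
    have hev : ∀ᶠ p : Ω × Ball m r in 𝓝 (ω, o), ‖D p.1 p.2.val‖ ≤ ε := by
      filter_upwards [hc.eventually (Metric.closedBall_mem_nhds _ hε)] with p hp
      simpa [ho] using hp
    rw [nhds_prod_eq] at hev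
    obtain ⟨U, hU, V, hV, h⟩ := eventually_prod_iff.1 hev
    obtain ⟨⟨b, δ⟩, hδ, hbδ⟩ := (nhds_basis_uniformity (hasBasis_uniformity_ball r)).mem_iff.1 hV
    refine ⟨{ω | U ω}, mem_nhdsWithin_of_mem_nhds hU, b, δ, hδ, fun ω' hω' z hz hzs => ?_⟩
    refine h hω' (y := ⟨z, hz⟩) (hbδ fun s hs => ?_)
    exact (dist_zero_right (z s)).trans_le (hzs s hs)

/-- `(s, ω) ↦ D(ω·s)` is norm-continuous, hence uniformly so on the compact set `[-a, 0] × Ω`. -/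
lemma exists_uniform_flow (hD1 : Continuous D) (a : ℝ) {ε : ℝ} (hε : 0 < ε) :
    ∃ η : ℝ, 0 < η ∧ ∀ ω ω' : Ω, dist ω ω' < η → ∀ s : Iic (0 : ℝ), -a ≤ s →
      ‖D (σ s ω) - D (σ s ω')‖ ≤ ε := by
  have hcont : Continuous fun p : ℝ × Ω => D (σ p.1 p.2) :=
    hD1.comp (σ.continuous continuous_fst continuous_snd)
  have hu := ((isCompact_Icc (a := -a) (b := 0)).prod
    (isCompact_univ (X := Ω))).uniformContinuousOn_of_continuous
      (β := BC m →L[ℝ] Vec m) (f := fun p : ℝ × Ω => D (σ p.1 p.2)) hcont.continuousOn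
  obtain ⟨η, hη, h⟩ := (Metric.uniformContinuousOn_iff (α := ℝ × Ω)
    (β := BC m →L[ℝ] Vec m)).1 hu ε hε
  refine ⟨η, hη, fun ω ω' hω s hs => ?_⟩
  rw [← dist_eq_norm (D (σ s ω)) (D (σ s ω'))]
  refine (h ((s : ℝ), ω) ⟨⟨hs, s.2⟩, mem_univ _⟩ ((s : ℝ), ω') ⟨⟨hs, s.2⟩, mem_univ _⟩ ?_).le
  simpa [Prod.dist_eq] using hω

/-- Uniform continuity of `D̂₂` on bounded sets, for uniform convergence on compact sets. -/
theorem exists_dist_DhatTwo_le (hD1 : Continuous D) (hD2 : IsContinuousOnBalls D) {r : ℝ}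
    (hr : 0 < r) (a : ℝ) {ε : ℝ} (hε : 0 < ε) :
    ∃ η b δ : ℝ, 0 < η ∧ 0 < δ ∧ ∀ (ω ω' : Ω) (x y : BC m), ‖x‖ ≤ r → ‖y‖ ≤ r →
      dist ω ω' < η → (∀ s : Iic (0 : ℝ), -b ≤ s → dist (x s) (y s) ≤ δ) →
      ∀ s : Iic (0 : ℝ), -a ≤ s → dist (DhatTwo σ D ω x s) (DhatTwo σ D ω' y s) ≤ ε := by
  obtain ⟨b, δ, hδ, htail⟩ := exists_tail hD2 (r := 2 * r) (by positivity) (half_pos hε)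
  obtain ⟨η, hη, hflow⟩ := exists_uniform_flow (σ := σ) hD1 a
    (show 0 < ε / 2 / (r + 1) by positivity)
  -- For `s ≥ -a`, the window `[-b, 0]` of `x_s` reaches back to `-(a + b)`.
  refine ⟨η, a + b, δ, hη, hδ, fun ω ω' x y hx hy hω hxy s hs => ?_⟩
  rw [dist_eq_norm, DhatTwo_sub_DhatTwo]
  refine (norm_add_le _ _).trans ((add_le_add (htail _ _ ?_ fun u hu => ?_)
    (norm_sub_history_le (half_pos hε).le hy (hflow ω ω' hω s hs))).trans (add_halves ε).le)
  · refine (norm_history_le _ _).trans ((norm_sub_le _ _).trans ?_)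
    linarith
  · rw [history_apply, BoundedContinuousFunction.sub_apply, ← dist_eq_norm]
    refine hxy _ ?_
    show -(a + b) ≤ (s + u : ℝ)
    linarith

/-- Uniform continuity of the inverse of `D̂₂` on bounded sets, for uniform convergence on compact
sets. -/
theorem exists_dist_le_of_DhatTwo (hD1 : Continuous D) {c : ℝ → ℝ} {K : ℝ} (hK0 : 0 ≤ K)
    (hc0 : ∀ t, 0 ≤ c t) (hc : Tendsto c atTop (𝓝 0)) (hap : APriori σ D c K) {r : ℝ}
    (hr : 0 ≤ r) (a : ℝ) {ε : ℝ} (hε : 0 < ε) :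
    ∃ η b δ : ℝ, 0 < η ∧ 0 < δ ∧ ∀ (ω ω' : Ω) (x y : BC m), ‖x‖ ≤ r → ‖y‖ ≤ r →
      dist ω ω' < η →
      (∀ s : Iic (0 : ℝ), -b ≤ s → dist (DhatTwo σ D ω x s) (DhatTwo σ D ω' y s) ≤ δ) →
      ∀ s : Iic (0 : ℝ), -a ≤ s → dist (x s) (y s) ≤ ε := by
  -- `D̂₂(ω, x - y)` is bounded by `δ` from the data plus `δ` from the base points; `K * (2 * δ)`
  -- uses half of `ε`, the decaying term the other half.
  set δ : ℝ := ε / (4 * (K + 1))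
  have hδ : 0 < δ := by positivity
  have hKδ : K * (2 * δ) ≤ ε / 2 := by
    have : δ * (4 * (K + 1)) = ε := div_mul_cancel₀ _ (by positivity)
    nlinarith
  obtain ⟨b, hab, hb⟩ := (eventually_le_of_tendsto hc a (2 * r + K * (2 * δ))
    (half_pos hε)).exists
  obtain ⟨η, hη, hflow⟩ := exists_uniform_flow (σ := σ) hD1 b (show 0 < δ / (r + 1) by positivity)
  refine ⟨η, b, δ, hη, hδ, fun ω ω' x y hx hy hω hxy t ht => ?_⟩
  have h := hap ω (x - y) b (2 * δ) (by positivity) (fun s hs => ?_) t (by linarith)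
  · rw [dist_eq_norm, ← BoundedContinuousFunction.sub_apply]
    have h1 : ‖x - y‖ ≤ 2 * r := (norm_sub_le _ _).trans (by linarith)
    have h2 : c (t + b) * (‖x - y‖ + K * (2 * δ)) ≤ c (t + b) * (2 * r + K * (2 * δ)) :=
      mul_le_mul_of_nonneg_left (by linarith) (hc0 _)
    linarith [hb t ht]
  · have e : DhatTwo σ D ω (x - y) s = (DhatTwo σ D ω x s - DhatTwo σ D ω' y s) -
        (D (σ s ω) - D (σ s ω')) (history y s) := by
      rw [DhatTwo_sub_DhatTwo, add_sub_cancel_right]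
    rw [e, two_mul]
    exact (norm_sub_le _ _).trans (add_le_add ((dist_eq_norm _ _).symm.trans_le (hxy s hs))
      (norm_sub_history_le hδ.le hy (hflow ω ω' hω s hs)))

end Uniform

end Estimates

end

section

variable {m : ℕ} {Ω : Type*} [TopologicalSpace Ω] [CompactSpace Ω] {D : Ω → BC m →L[ℝ] Vec m}

/-- The linear map `D̂₂(ω, ·) : BC → BC`. -/
lemma exists_linearMap_DhatTwo (σ : Flow ℝ Ω) (hD1 : Continuous D) (hD2 : IsContinuousOnBalls D) :
    ∃ C : ℝ, 0 ≤ C ∧ ∃ A : Ω → BC m →ₗ[ℝ] BC m, (∀ ω x, ⇑(A ω x) = DhatTwo σ D ω x) ∧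
      ∀ ω x, ‖A ω x‖ ≤ C * ‖x‖ := by
  obtain ⟨C, hC⟩ := isCompact_univ.exists_bound_of_continuousOn
    (E := BC m →L[ℝ] Vec m) (f := D) hD1.continuousOn
  have hb : ∀ ω x s, ‖DhatTwo σ D ω x s‖ ≤ max C 0 * ‖x‖ := fun ω x s =>
    ((D (σ s ω)).le_opNorm _).trans (mul_le_mul ((hC _ (mem_univ _)).trans (le_max_left _ _))
      (norm_history_le x s) (norm_nonneg _) (le_max_right _ _))
  let A : Ω → BC m →ₗ[ℝ] BC m := fun ω =>
    { toFun := fun x => BoundedContinuousFunction.ofNormedAddCommGroup (DhatTwo σ D ω x)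
        (continuous_DhatTwo hD2 ω x) _ (hb ω x)
      map_add' := fun x y => DFunLike.coe_injective (DhatTwo_add ω x y)
      map_smul' := fun r x => DFunLike.coe_injective (DhatTwo_smul ω r x) }
  exact ⟨max C 0, le_max_right _ _, A, fun _ _ => rfl, fun ω x =>
    BoundedContinuousFunction.norm_ofNormedAddCommGroup_le _ (by positivity) (hb ω x)⟩

end

end StableNFDE

end

/-! ### Assembly of the homeomorphism -/

theorem mainTheorem3 {Ω : Type*} [MetricSpace Ω] [CompactSpace Ω]
    (σ : Flow ℝ Ω) (hσ : StableNFDE.IsMinimalFlow σ) {m : ℕ}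
    (D : Ω → StableNFDE.BC m →L[ℝ] StableNFDE.Vec m)
    (hD1 : Continuous D)
    (hD2 : StableNFDE.IsContinuousOnBalls D)
    (hD3 : StableNFDE.HasIdentityAtom D)
    (hD4 : StableNFDE.IsStable σ D) :
    -- the map is well defined and invertible
    ∃ Dhat : (Ω × StableNFDE.BC m) ≃ (Ω × StableNFDE.BC m),
      (∀ (ω : Ω) (x : StableNFDE.BC m),
        (Dhat (ω, x)).1 = ω ∧ ⇑(Dhat (ω, x)).2 = StableNFDE.DhatTwo σ D ω x) ∧
      -- the second components are linear and norm-continuous in their second variable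
      (∀ ω : Ω,
        (IsLinearMap ℝ (fun x : StableNFDE.BC m => (Dhat (ω, x)).2) ∧
          Continuous (fun x : StableNFDE.BC m => (Dhat (ω, x)).2)) ∧
        (IsLinearMap ℝ (fun x : StableNFDE.BC m => (Dhat.symm (ω, x)).2) ∧
          Continuous (fun x : StableNFDE.BC m => (Dhat.symm (ω, x)).2))) ∧
      -- uniform continuity on each `Ω × B_r` for the compact-open topology
      StableNFDE.IsUniformlyContinuousOnBalls Dhat ∧
      StableNFDE.IsUniformlyContinuousOnBalls Dhat.symm := by

  obtain ⟨l, hl⟩ := StableNFDE.exists_expWeight hD1 hD2 hD3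
  obtain ⟨c, hc0, hc, hdec⟩ := hD4.exists_decays
  obtain ⟨K, hK0, hK⟩ := StableNFDE.exists_bounded_solution hD2 hl hc hdec
  have hap : StableNFDE.APriori σ D c K := fun ω z b ε hε hz t ht =>
    StableNFDE.norm_le_of_DhatTwo_le hD1 hD2 hl hdec hK0 hK hε hz t ht
  obtain ⟨C, hC0, A, hA, hAC⟩ := StableNFDE.exists_linearMap_DhatTwo σ hD1 hD2
  have hinj : ∀ ω, Function.Injective (A ω) := fun ω => by
    refine (injective_iff_map_eq_zero (A ω)).2 fun z hz => ?_
    refine StableNFDE.eq_zero_of_DhatTwo_eq_zero hc hap (ω := ω) ?_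
    rw [← hA, hz]
    rfl
  have hsurj : ∀ ω h, ∃ x, ‖x‖ ≤ K * ‖h‖ ∧ A ω x = h := fun ω h => by
    obtain ⟨x, hx, e⟩ := StableNFDE.exists_DhatTwo_eq hD2 hK0 hc0 hc hap hK ω h
    exact ⟨x, hx, DFunLike.coe_injective ((hA ω x).trans e)⟩
  let Φ : Ω → StableNFDE.BC m ≃ₗ[ℝ] StableNFDE.BC m := fun ω =>
    LinearEquiv.ofBijective (A ω) ⟨hinj ω, fun h => (hsurj ω h).imp fun _ hx => hx.2⟩
  have hΦ : ∀ ω x, ⇑(Φ ω x) = StableNFDE.DhatTwo σ D ω x := hA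
  have hΦsymm : ∀ ω h, ‖(Φ ω).symm h‖ ≤ K * ‖h‖ := fun ω h => by
    obtain ⟨x, hx, e⟩ := hsurj ω h
    have : (Φ ω).symm h = x := (Φ ω).symm_apply_eq.2 e.symm
    rwa [this]
  refine ⟨⟨fun p => (p.1, Φ p.1 p.2), fun p => (p.1, (Φ p.1).symm p.2),
    fun p => by simp, fun p => by simp⟩, fun ω x => ⟨rfl, hΦ ω x⟩, fun ω =>
    ⟨⟨(Φ ω).toLinearMap.isLinear, ?_⟩, ⟨(Φ ω).symm.toLinearMap.isLinear, ?_⟩⟩,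
    fun r hr => ?_, fun r hr => ?_⟩
  · exact ((Φ ω).toLinearMap.mkContinuous C (hAC ω)).continuous
  · exact ((Φ ω).symm.toLinearMap.mkContinuous K (hΦsymm ω)).continuous
  · refine uniformContinuous_fst.prodMk (StableNFDE.uniformContinuous_of_dist_le fun a ε hε => ?_)
    obtain ⟨η, b, δ, hη, hδ, H⟩ := StableNFDE.exists_dist_DhatTwo_le (σ := σ) hD1 hD2 hr a hε
    exact ⟨η, b, δ, hη, hδ, fun p q hpq h s hs => by
      have := H p.1 q.1 p.2.val q.2.val p.2.2 q.2.2 hpq h s hs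
      rwa [← hΦ, ← hΦ] at this⟩
  · refine uniformContinuous_fst.prodMk (StableNFDE.uniformContinuous_of_dist_le fun a ε hε => ?_)
    obtain ⟨η, b, δ, hη, hδ, H⟩ := StableNFDE.exists_dist_le_of_DhatTwo (σ := σ) hD1 hK0 hc0 hc hap
      (show 0 ≤ K * r by positivity) a hε
    refine ⟨η, b, δ, hη, hδ, fun p q hpq h s hs => ?_⟩
    -- The inverse maps `B_r` into the ball of radius `K * r`, on which the estimate for preimages
    -- was taken.
    have hbd : ∀ p : Ω × StableNFDE.Ball m r, ‖(Φ p.1).symm p.2.val‖ ≤ K * r := fun p =>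
      (hΦsymm _ _).trans (mul_le_mul_of_nonneg_left p.2.2 hK0)
    refine H p.1 q.1 _ _ (hbd p) (hbd q) hpq (fun s hs => ?_) s hs
    rw [← hΦ, ← hΦ, LinearEquiv.apply_symm_apply, LinearEquiv.apply_symm_apply]
    exact h s hs
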